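/- \textbf{Definitions.} A convex polygon is a compact subset of $\mathbb{R}^2$ that is the intersection of finitely many closed half-planes, and a PL set is a finite union of convex polygons. A vertex of a PL set $S$ is a point $p$ of the topological boundary $\partial S$ such that, for all sufficiently small $r>0$, the intersection of $\partial S$ with the closed disk of radius $r$ about $p$ is not a nondegenerate straight line segment having $p$ in its relative interior (so isolated boundary points and free ends of segments are vertices). A PL set is generic if distinct vertices have distinct $x$-coordinates. For $\varepsilon>0$, an $\varepsilon$-pixel is a closed square $[(i-1)\varepsilon,i\varepsilon]\times[(j-1)\varepsilon,j\varepsilon]$ with $i,j\in\mathbb{Z}$. For $x\in\mathbb{R}\setminus\varepsilon\mathbb{Z}$ let $\boldsymbol n_{S,\varepsilon}(x)$ be the number of connected components of the union of all $\varepsilon$-pixels that intersect both $S$ and the vertical line through $(x,0)$. For $x\in\mathbb{R}$ let $\boldsymbol n_S(x)$ be the number of connected components of $\{y\in\mathbb{R}:(x,y)\in S\}$. A jumping point of $\boldsymbol n_S$ is an $x_0\in\mathbb{R}$ such that $\boldsymbol n_S(x_0)\ne\lim_{x\nearrow x_0}\boldsymbol n_S(x)$ or $\boldsymbol n_S(x_0)\neq\lim_{x\searrow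 x_0}\boldsymbol n_S(x)$; the set of these points is $\mathcal J_S$. A jumping point of $\boldsymbol n_{S,\varepsilon}$ is an $x_0\in\varepsilon\mathbb{Z}$ such that $\lim_{x\nearrow x_0}\boldsymbol n_{S,\varepsilon}(x)\neq\lim_{x\searrow x_0}\boldsymbol n_{S,\varepsilon}(x)$. Call a pair $(\nu,\varepsilon_0)$, with $\nu$ a positive integer and $\varepsilon_0>0$, a noise bound for $S$ if $\boldsymbol n_{S,\varepsilon}(x)=\boldsymbol n_S(x)$ whenever $0<\varepsilon<\varepsilon_0$, $x\in\mathbb{R}\setminus\varepsilon\mathbb{Z}$ and $|x-x_0|\ge\nu\varepsilon$ for all $x_0\in\mathcal J_S$. \textbf{Theorem.} Let $S\subset\mathbb{R}^2$ be a generic PL set. Then a noise bound for $S$ exists. Moreover, for every noise bound $(\nu,\varepsilon_0)$ for $S$ there is $\varepsilon_1>0$ such that, whenever $0<\varepsilon<\min(\varepsilon_0,\varepsilon_1)$ and $x_0$ is a jumping point of $\boldsymbol n_S$, the function $\boldsymbol n_{S,\varepsilon}$ has at least one jumping point in the interval $[x_0-\nu\varepsilon,\,x_0+\nu\varepsilon]$.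 -/

import Mathlib

open Set Filter Topology

namespace Pixelation

/-- The number of connected components of a set (used below only for sets with finitely many
components). -/
noncomputable def componentCount {X : Type*} [TopologicalSpace X] (A : Set X) : ℕ :=
  Nat.card (ConnectedComponents A)

/-! ### Generic piecewise linear sets in the plane -/

/-- A closed half-plane `{(x, y) | a x + b y ≤ c}` with `(a, b) ≠ (0, 0)`. -/
def IsClosedHalfPlane (H : Set (ℝ × ℝ)) : Prop :=
  ∃ a b c : ℝ, (a ≠ 0 ∨ b ≠ 0) ∧ H = {p : ℝ × ℝ | a * p.1 + b * p.2 ≤ c}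

/-- A convex polygon: a compact set which is the intersection of finitely many closed
half-planes (points and line segments are allowed). -/
def IsConvexPolygon (P : Set (ℝ × ℝ)) : Prop :=
  IsCompact P ∧ ∃ F : Set (Set (ℝ × ℝ)), F.Finite ∧ (∀ H ∈ F, IsClosedHalfPlane H) ∧ P = ⋂₀ F

/-- A PL set: a finite union of convex polygons. -/
def IsPLSet (S : Set (ℝ × ℝ)) : Prop :=
  ∃ F : Set (Set (ℝ × ℝ)), F.Finite ∧ (∀ P ∈ F, IsConvexPolygon P) ∧ S = ⋃₀ F

/-- The closed Euclidean disk with centre `p` and radius `r` (for `r ≥ 0`); the default metric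
on `ℝ × ℝ` in Mathlib is the sup metric, so the disk is written out. -/
def closedDisk (p : ℝ × ℝ) (r : ℝ) : Set (ℝ × ℝ) :=
  {q : ℝ × ℝ | (q.1 - p.1) ^ 2 + (q.2 - p.2) ^ 2 ≤ r ^ 2}

/-- A vertex of `S`: a point `p` of the topological boundary such that, for all sufficiently small
`r > 0`, the part of the boundary in the closed disk of radius `r` about `p` is not a straight
line segment passing through `p`, i.e. a nondegenerate segment with `p` in its relative interior.
Thus isolated points of the boundary and free ends of segments are vertices. -/
def IsVertex (S : Set (ℝ × ℝ)) (p : ℝ × ℝ) : Prop :=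
  p ∈ frontier S ∧ ∀ᶠ r in 𝓝[>] (0 : ℝ),
    ¬ ∃ a b : ℝ × ℝ, a ≠ b ∧ p ∈ openSegment ℝ a b ∧ frontier S ∩ closedDisk p r = segment ℝ a b

/-- A generic PL set: distinct vertices have distinct `x`-coordinates. -/
def IsGenericPLSet (S : Set (ℝ × ℝ)) : Prop :=
  IsPLSet S ∧ ∀ p q : ℝ × ℝ, IsVertex S p → IsVertex S q → p ≠ q → p.1 ≠ q.1

/-! ### Pixels, columns and the two counting functions -/

/-- The closed `ε`-pixel `[(i-1)ε, iε] × [(j-1)ε, jε]`. -/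
def pixel (ε : ℝ) (i j : ℤ) : Set (ℝ × ℝ) :=
  Icc (((i : ℝ) - 1) * ε) ((i : ℝ) * ε) ×ˢ Icc (((j : ℝ) - 1) * ε) ((j : ℝ) * ε)

/-- The `ε`-pixels that intersect `S`. -/
def pixels (ε : ℝ) (S : Set (ℝ × ℝ)) : Set (Set (ℝ × ℝ)) :=
  {Q : Set (ℝ × ℝ) | (∃ i j : ℤ, Q = pixel ε i j) ∧ (Q ∩ S).Nonempty}

/-- The column of the `ε`-pixelation of `S` over `a`: the union of the pixels of the pixelation
that intersect the vertical line `{x = a}`. It is meant for `ε`-generic `a`. -/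
def column (ε : ℝ) (S : Set (ℝ × ℝ)) (a : ℝ) : Set (ℝ × ℝ) :=
  ⋃₀ {Q ∈ pixels ε S | ∃ y : ℝ, (a, y) ∈ Q}

/-- The point `a` is `ε`-generic: it does not lie in `εℤ`. -/
def IsGenericPoint (ε a : ℝ) : Prop := ∀ k : ℤ, a ≠ (k : ℝ) * ε

/-- The stack counter: the number of components of the column over `a` (for `ε`-generic `a`). -/
noncomputable def stackCount (S : Set (ℝ × ℝ)) (ε a : ℝ) : ℕ :=
  componentCount (column ε S a)

/-- The component counter: the number of components of `{y | (x, y) ∈ S}`. -/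
noncomputable def fiberCount (S : Set (ℝ × ℝ)) (x : ℝ) : ℕ :=
  componentCount {y : ℝ | (x, y) ∈ S}

/-- The jumping set of `S`: the points at which the component counter differs from its left limit
or from its right limit. -/
def jumpSet (S : Set (ℝ × ℝ)) : Set ℝ :=
  {x₀ : ℝ | (∃ m : ℕ, Tendsto (fiberCount S) (𝓝[<] x₀) (𝓝 m) ∧ fiberCount S x₀ ≠ m) ∨
    (∃ m : ℕ, Tendsto (fiberCount S) (𝓝[>] x₀) (𝓝 m) ∧ fiberCount S x₀ ≠ m)}

/-- The `ε`-jumping set of `S`: the points of `εℤ` at which the left and right limits of the stack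
counter differ. (Near a point of `εℤ`, all other points are `ε`-generic, so the value of
`stackCount` at points that are not generic plays no role.) -/
def pixelJumpSet (S : Set (ℝ × ℝ)) (ε : ℝ) : Set ℝ :=
  {x₀ : ℝ | (∃ k : ℤ, x₀ = (k : ℝ) * ε) ∧
    ∃ m₁ m₂ : ℕ, Tendsto (stackCount S ε) (𝓝[<] x₀) (𝓝 m₁) ∧
      Tendsto (stackCount S ε) (𝓝[>] x₀) (𝓝 m₂) ∧ m₁ ≠ m₂}

/-- The positive constants `ν` and `ε₀` are a noise range and a resolution bound for `S`: for
`0 < ε < ε₀` the two counters agree at every `ε`-generic point at distance at least `ν ε` from the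
jumping set. -/
def IsNoiseBound (S : Set (ℝ × ℝ)) (ν : ℕ) (ε₀ : ℝ) : Prop :=
  0 < ν ∧ 0 < ε₀ ∧ ∀ ε : ℝ, 0 < ε → ε < ε₀ → ∀ x : ℝ, IsGenericPoint ε x →
    (∀ x₀ ∈ jumpSet S, (ν : ℝ) * ε ≤ |x - x₀|) → stackCount S ε x = fiberCount S x

end Pixelation

/-!
A PL set is a finite union of convex polygons `P i`. A vertical line meets each of them in a closed
interval, and a column of pixels meets each of them in a convex set, so that the pixels of the column
meeting `P i` form a connected set. Hence both counting functions are the number of classes of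
indices under chains of overlaps (`componentCount_iUnion`), and they agree wherever the overlap
relation of the fibers and the overlap relation of the pixel columns agree, or at least generate
equally many classes.

Fix `x₀`. On either side of `x₀`, over points `x₀ + σ t` with small `t > 0`, the nonempty fibers of
the polygons are intervals whose end points are affine in `t`, and any two such end points are
ordered in the same way for all small `t` (`exists_isSideData`). So the overlap relation of the
fibers is a constant `R` there, and disjoint fibers are at distance at least a constant times `t`;
at distance `ν ε` from `x₀` this exceeds the height of two pixels, and a column has the overlaps `R`
(`IsSideData.exists_overlap_strip_eq`). By compactness, a small column near `x₀` can only have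
overlaps that occur over `x₀` (`exists_overlap_fiber_of_overlap_strip`). In particular the column
over `x₀` itself has exactly the overlaps of the fiber over `x₀`.

Genericity enters at points `x₀` that are not jumping points. A column close to `x₀` has overlaps
between `R` and those over `x₀`, and the two extremes have the same number of classes. If the map
between their classes is not a bijection, it is neither injective nor surjective. In the first case
a gap on the side closes over `x₀`, which creates a vertex that is a limit of points of `S` on that
side; in the second case a component of the fiber over `x₀` is not continued to that side, and its
lowest point is a vertex that is not such a limit. These are two vertices over `x₀`, a contradiction
(`IsSideData.overlapCount_strip_eq`). A compactness argument turns the local noise ranges into a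
noise bound (`exists_isNoiseBound`).

For the jumps, let `x₀` be a jumping point at which the number of components differs, say, from
that to the left. The column over `x₀` counts the components over `x₀`, while by the noise bound the
column reaching to the left of `x₀ - ν ε` counts those to the left of `x₀`. So the stack counter
jumps between these two columns (`exists_mem_pixelJumpSet`). There are only finitely many jumping
points (`finite_jumpSet`), which gives a uniform threshold for `ε`.
-/

namespace Pixelation

/-! ### Counting components through overlaps -/

/-- The number of classes of the equivalence relation generated by `r` on the indices `i` with
`r i i`. For the relation "`T i` meets `T j`" these are the indices of the nonempty members. -/
noncomputable def overlapCount {ι : Type*} (r : ι → ι → Prop) : ℕ :=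
  Nat.card (Quot fun i j : {i // r i i} => r i j)

/-- The relation "`T i` meets `T j`" between the indices of a family of sets. -/
def Overlap {ι X : Type*} (T : ι → Set X) (i j : ι) : Prop := (T i ∩ T j).Nonempty

/-- The class of `i` under chains of overlapping members of the family `T`. -/
def overlapClass {ι X : Type*} (T : ι → Set X) (i : {i // Overlap T i i}) :
    Quot fun i j : {i // Overlap T i i} => Overlap T i j := Quot.mk _ i

section Components

variable {ι X : Type*} {T : ι → Set X}

lemma Overlap.nonempty {i : ι} (h : Overlap T i i) : (T i).Nonempty := h.mono inter_subset_left

lemma overlap_self_of_mem {i : ι} {x : X} (h : x ∈ T i) : Overlap T i i := ⟨x, h, h⟩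

lemma overlapClass_eq_of_overlap {i j : {i // Overlap T i i}} (h : Overlap T i j) :
    overlapClass T i = overlapClass T j := Quot.sound h

variable [TopologicalSpace X]

lemma exists_isPreconnected_of_overlapClass_eq (hT : ∀ i, IsPreconnected (T i))
    {i j : {i // Overlap T i i}} (h : overlapClass T i = overlapClass T j) :
    ∃ C ⊆ ⋃ k, T k, IsPreconnected C ∧ T i ⊆ C ∧ T j ⊆ C := by
  replace h := Quot.eqvGen_exact h
  induction h with
  | rel i j h =>
    obtain ⟨x, hi, hj⟩ := h
    exact ⟨T i ∪ T j, union_subset (subset_iUnion T _) (subset_iUnion T _),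
      IsPreconnected.union x hi hj (hT i) (hT j), subset_union_left, subset_union_right⟩
  | refl i => exact ⟨T i, subset_iUnion T _, hT i, le_rfl, le_rfl⟩
  | symm i j h ih =>
    obtain ⟨C, h1, h2, h3, h4⟩ := ih
    exact ⟨C, h1, h2, h4, h3⟩
  | trans i j k h h' ih ih' =>
    obtain ⟨C, h1, h2, h3, h4⟩ := ih
    obtain ⟨C', h1', h2', h3', h4'⟩ := ih'
    obtain ⟨x, hx⟩ := j.2.nonempty
    exact ⟨C ∪ C', union_subset h1 h1', IsPreconnected.union x (h4 hx) (h3' hx) h2 h2',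
      h3.trans subset_union_left, h4'.trans subset_union_right⟩

lemma overlapClass_eq_of_isPreconnected [Finite ι] (hc : ∀ i, IsClosed (T i))
    {i j : {i // Overlap T i i}} {C : Set X} (hC : IsPreconnected C) (hCT : C ⊆ ⋃ k, T k)
    (hi : (C ∩ T i).Nonempty) (hj : (C ∩ T j).Nonempty) :
    overlapClass T i = overlapClass T j := by
  by_contra hne
  -- the class of `i` and the remaining members cover `C` by two disjoint closed sets
  obtain ⟨x, -, hx1, hx2⟩ := isPreconnected_closed_iff.1 hC
    (⋃ k : {k // overlapClass T k = overlapClass T i}, T k)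
    (⋃ k : {k // overlapClass T k ≠ overlapClass T i}, T k)
    (isClosed_iUnion_of_finite fun k => hc _) (isClosed_iUnion_of_finite fun k => hc _)
    (by
      intro x hx
      obtain ⟨k, hk⟩ := mem_iUnion.1 (hCT hx)
      by_cases h : overlapClass T ⟨k, overlap_self_of_mem hk⟩ = overlapClass T i
      · exact Or.inl (mem_iUnion.2 ⟨⟨_, h⟩, hk⟩)
      · exact Or.inr (mem_iUnion.2 ⟨⟨_, h⟩, hk⟩))
    (hi.mono (inter_subset_inter_right _ fun x hx => mem_iUnion.2 ⟨⟨i, rfl⟩, hx⟩))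
    (hj.mono (inter_subset_inter_right _ fun x hx => mem_iUnion.2 ⟨⟨j, Ne.symm hne⟩, hx⟩))
  obtain ⟨⟨k, hk⟩, hxk⟩ := mem_iUnion.1 hx1
  obtain ⟨⟨m, hm⟩, hxm⟩ := mem_iUnion.1 hx2
  exact hm ((overlapClass_eq_of_overlap ⟨x, hxm, hxk⟩).trans hk)

lemma connectedComponents_mk_eq_iff {A : Set X} (x y : A) :
    (ConnectedComponents.mk x = ConnectedComponents.mk y) ↔
      ∃ C ⊆ A, IsPreconnected C ∧ x.1 ∈ C ∧ y.1 ∈ C := by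
  rw [ConnectedComponents.coe_eq_coe]
  constructor
  · intro h
    refine ⟨Subtype.val '' connectedComponent x, by simp,
      isPreconnected_connectedComponent.image _ continuous_subtype_val.continuousOn,
      mem_image_of_mem _ mem_connectedComponent, mem_image_of_mem _ ?_⟩
    rw [h]; exact mem_connectedComponent
  · rintro ⟨C, hCA, hC, hx, hy⟩
    have : IsPreconnected (Subtype.val ⁻¹' C : Set A) := by
      rw [← IsInducing.subtypeVal.isPreconnected_image, Subtype.image_preimage_coe,
        inter_eq_right.2 hCA]
      exact hC
    exact connectedComponent_eq (this.subset_connectedComponent hx hy)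

/-- The components of a finite union of closed preconnected sets are the classes of the nonempty
members under chains of overlaps. -/
theorem componentCount_iUnion [Finite ι] (hc : ∀ i, IsClosed (T i))
    (hT : ∀ i, IsPreconnected (T i)) :
    componentCount (⋃ i, T i) = overlapCount (Overlap T) := by
  have key : ∀ i j : {i // Overlap T i i},
      (ConnectedComponents.mk (⟨_, mem_iUnion_of_mem _ i.2.nonempty.some_mem⟩ : ↥(⋃ i, T i)) =
        ConnectedComponents.mk ⟨_, mem_iUnion_of_mem _ j.2.nonempty.some_mem⟩) ↔
      overlapClass T i = overlapClass T j := by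
    intro i j
    rw [connectedComponents_mk_eq_iff]
    constructor
    · rintro ⟨C, h1, h2, h3, h4⟩
      exact overlapClass_eq_of_isPreconnected hc h2 h1 ⟨_, h3, i.2.nonempty.some_mem⟩
        ⟨_, h4, j.2.nonempty.some_mem⟩
    · intro h
      obtain ⟨C, h1, h2, h3, h4⟩ := exists_isPreconnected_of_overlapClass_eq hT h
      exact ⟨C, h1, h2, h3 i.2.nonempty.some_mem, h4 j.2.nonempty.some_mem⟩
  refine (Nat.card_congr (Equiv.ofBijective (Quot.lift
    (fun i : {i // Overlap T i i} => ConnectedComponents.mk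
      (⟨_, mem_iUnion_of_mem _ i.2.nonempty.some_mem⟩ : ↥(⋃ i, T i)))
    fun i j h => (key i j).2 (Quot.sound h)) ⟨?_, ?_⟩)).symm
  · rintro ⟨i⟩ ⟨j⟩ h
    exact (key i j).1 h
  · intro c
    obtain ⟨⟨x, hx⟩, rfl⟩ := ConnectedComponents.surjective_coe c
    obtain ⟨i, hi⟩ := mem_iUnion.1 hx
    exact ⟨Quot.mk _ ⟨i, overlap_self_of_mem hi⟩, (connectedComponents_mk_eq_iff _ _).2
      ⟨T i, subset_iUnion T i, hT i, (overlap_self_of_mem hi).nonempty.some_mem, hi⟩⟩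

end Components

/-- If `r ≤ r'` induces a bijection of classes, then any relation between the two with the diagonal
of `r` has as many classes as `r`. -/
lemma overlapCount_eq_of_between {ι : Type*} [Finite ι] {r s r' : ι → ι → Prop}
    (hrs : ∀ i j, r i j → s i j) (hsr' : ∀ i j, s i j → r' i j) (hdiag : ∀ i, s i i → r i i)
    (hinj : ∀ (i j) (hi : r i i) (hj : r j j),
      (Quot.mk _ ⟨i, hsr' _ _ (hrs _ _ hi)⟩ : Quot fun i j : {i // r' i i} => r' i j) =
        Quot.mk _ ⟨j, hsr' _ _ (hrs _ _ hj)⟩ →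
      (Quot.mk _ ⟨i, hi⟩ : Quot fun i j : {i // r i i} => r i j) = Quot.mk _ ⟨j, hj⟩) :
    overlapCount s = overlapCount r := by
  refine (Nat.card_congr (Equiv.ofBijective (Quot.map
    (fun i : {i // r i i} => (⟨i, hrs _ _ i.2⟩ : {i // s i i}))
    fun i j h => hrs _ _ h) ⟨?_, ?_⟩)).symm
  · rintro ⟨i⟩ ⟨j⟩ h
    exact hinj i j i.2 j.2 (congrArg (Quot.map (rb := fun i j : {i // r' i i} => r' i j)
      (fun i : {i // s i i} => (⟨i, hsr' _ _ i.2⟩ : {i // r' i i})) fun i j h => hsr' _ _ h) h)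
  · rintro ⟨i⟩
    exact ⟨Quot.mk _ ⟨i, hdiag _ i.2⟩, rfl⟩

/-! ### Fibers and pixel columns -/

/-- The vertical fiber of `S` over `x`. -/
def fiber (S : Set (ℝ × ℝ)) (x : ℝ) : Set ℝ := {y | (x, y) ∈ S}

/-- The `k`-th column of the `ε`-pixelation of `S`, lying over `[(k - 1) ε, k ε]`. -/
def strip (ε : ℝ) (S : Set (ℝ × ℝ)) (k : ℤ) : Set (ℝ × ℝ) :=
  ⋃ j ∈ {j : ℤ | (pixel ε k j ∩ S).Nonempty}, pixel ε k j

/-- The open interval over which the `k`-th column of pixels lies. -/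
def cell (ε : ℝ) (k : ℤ) : Set ℝ := Ioo (((k : ℝ) - 1) * ε) ((k : ℝ) * ε)

/-- The closed interval over which the `k`-th column of pixels lies. -/
def closedCell (ε : ℝ) (k : ℤ) : Set ℝ := Icc (((k : ℝ) - 1) * ε) ((k : ℝ) * ε)

lemma cell_subset_closedCell (ε : ℝ) (k : ℤ) : cell ε k ⊆ closedCell ε k := Ioo_subset_Icc_self

lemma abs_sub_le_of_mem_closedCell {ε : ℝ} {k : ℤ} {x y : ℝ} (hx : x ∈ closedCell ε k)
    (hy : y ∈ closedCell ε k) : |x - y| ≤ ε := by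
  have := abs_sub_le_of_le_of_le hx.1 hx.2 hy.1 hy.2
  linarith

lemma IsGenericPoint.exists_mem_cell {ε x : ℝ} (hε : 0 < ε) (hx : IsGenericPoint ε x) :
    ∃ k : ℤ, x ∈ cell ε k := by
  refine ⟨⌈x / ε⌉, ?_, lt_of_le_of_ne ?_ (hx _)⟩
  · rw [← lt_div_iff₀ hε]; linarith [Int.ceil_lt_add_one (x / ε)]
  · rw [← div_le_iff₀ hε]; exact Int.le_ceil _

lemma eq_of_mem_cell_of_mem_closedCell {ε x : ℝ} (hε : 0 < ε) {k m : ℤ} (hk : x ∈ cell ε k)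
    (hm : x ∈ closedCell ε m) : m = k := by
  have h1 : ((m : ℝ) - 1) < k := lt_of_mul_lt_mul_right (hm.1.trans_lt hk.2) hε.le
  have h2 : ((k : ℝ) - 1) < m := lt_of_mul_lt_mul_right (hk.1.trans_le hm.2) hε.le
  have h1' : m - 1 < k := by exact_mod_cast h1
  have h2' : k - 1 < m := by exact_mod_cast h2
  omega

lemma isGenericPoint_of_mem_cell {ε x : ℝ} (hε : 0 < ε) {k : ℤ} (hk : x ∈ cell ε k) :
    IsGenericPoint ε x := by
  rintro m rfl
  have h1 : (m : ℝ) < k := lt_of_mul_lt_mul_right hk.2 hε.le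
  have h2 : ((k : ℝ) - 1) < m := lt_of_mul_lt_mul_right hk.1 hε.le
  have h1' : m < k := by exact_mod_cast h1
  have h2' : k - 1 < m := by exact_mod_cast h2
  omega

lemma column_eq_strip {ε x : ℝ} (hε : 0 < ε) {k : ℤ} (hk : x ∈ cell ε k) (S : Set (ℝ × ℝ)) :
    column ε S x = strip ε S k := by
  ext p
  simp only [column, strip, pixels, mem_sUnion, mem_iUnion, mem_ofPred_eq, exists_prop]
  constructor
  · rintro ⟨Q, ⟨⟨⟨i, j, rfl⟩, hne⟩, y, hy⟩, hp⟩
    obtain rfl := eq_of_mem_cell_of_mem_closedCell hε hk hy.1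
    exact ⟨j, hne, hp⟩
  · rintro ⟨j, hne, hp⟩
    exact ⟨_, ⟨⟨⟨k, j, rfl⟩, hne⟩, p.2, cell_subset_closedCell ε k hk, hp.2⟩, hp⟩

lemma stackCount_eq {ε x : ℝ} (hε : 0 < ε) {k : ℤ} (hk : x ∈ cell ε k) (S : Set (ℝ × ℝ)) :
    stackCount S ε x = componentCount (strip ε S k) := by
  rw [stackCount, column_eq_strip hε hk]

lemma exists_mem_closedCell {ε : ℝ} (hε : 0 < ε) (y : ℝ) : ∃ j : ℤ, y ∈ closedCell ε j := by
  refine ⟨⌈y / ε⌉, ?_, ?_⟩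
  · rw [← le_div_iff₀ hε]; linarith [Int.ceil_lt_add_one (y / ε)]
  · rw [← div_le_iff₀ hε]; exact Int.le_ceil _

lemma mem_strip {ε : ℝ} (hε : 0 < ε) {k : ℤ} {S : Set (ℝ × ℝ)} {p : ℝ × ℝ} (hp : p ∈ S)
    (hk : p.1 ∈ closedCell ε k) : p ∈ strip ε S k := by
  obtain ⟨j, hj⟩ := exists_mem_closedCell hε p.2
  exact mem_biUnion (x := j) ⟨p, ⟨hk, hj⟩, hp⟩ ⟨hk, hj⟩

lemma strip_iUnion {ι : Type*} (ε : ℝ) (P : ι → Set (ℝ × ℝ)) (k : ℤ) :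
    strip ε (⋃ i, P i) k = ⋃ i, strip ε (P i) k := by
  ext p
  simp only [strip, inter_iUnion, nonempty_iUnion, mem_iUnion, mem_ofPred_eq, exists_prop]
  exact ⟨fun ⟨j, ⟨i, h⟩, hp⟩ => ⟨i, j, h, hp⟩, fun ⟨i, j, h, hp⟩ => ⟨j, ⟨i, h⟩, hp⟩⟩

lemma isClosed_strip {ε : ℝ} (hε : 0 < ε) {P : Set (ℝ × ℝ)} (hP : IsCompact P) (k : ℤ) :
    IsClosed (strip ε P k) := by
  obtain ⟨R, hR⟩ := hP.isBounded.subset_closedBall 0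
  refine Finite.isClosed_biUnion ((Set.finite_Icc ⌊-R / ε⌋ ⌈R / ε + 1⌉).subset ?_)
    fun j _ => isClosed_Icc.prod isClosed_Icc
  rintro j ⟨p, hpj, hpP⟩
  have h1 : |p.2| ≤ R := by
    have := mem_closedBall_zero_iff.1 (hR hpP)
    exact (norm_snd_le p).trans this
  rw [abs_le] at h1
  have h2 := hpj.2
  constructor
  · have : -R / ε ≤ j := by rw [div_le_iff₀ hε]; linarith [h2.2]
    exact_mod_cast (Int.floor_le _).trans this
  · have : (j : ℝ) - 1 ≤ R / ε := by rw [le_div_iff₀ hε]; linarith [h2.1]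
    have h3 : (j : ℝ) ≤ R / ε + 1 := by linarith
    exact_mod_cast h3.trans (Int.le_ceil _)

lemma isPreconnected_strip {ε : ℝ} (hε : 0 < ε) {P : Set (ℝ × ℝ)} (hP : Convex ℝ P) (k : ℤ) :
    IsPreconnected (strip ε P k) := by
  have hD : Convex ℝ (P ∩ closedCell ε k ×ˢ univ) :=
    hP.inter ((convex_Icc _ _).prod convex_univ)
  -- each pixel of the column meets the connected set `P ∩ (closedCell ε k ×ˢ univ)`
  have hsub : P ∩ closedCell ε k ×ˢ univ ⊆ strip ε P k := fun p hp => mem_strip hε hp.1 hp.2.1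
  rcases (P ∩ closedCell ε k ×ˢ univ).eq_empty_or_nonempty with h | ⟨d, hd⟩
  · have : strip ε P k = ∅ := by
      rw [strip, biUnion_eq_iUnion, iUnion_eq_empty]
      rintro ⟨j, p, hp1, hp2⟩
      exact (h.subset ⟨hp2, hp1.1, trivial⟩).elim
    rw [this]; exact isPreconnected_empty
  · refine isPreconnected_of_forall d fun p hp => ?_
    obtain ⟨j, ⟨q, hqj, hqP⟩, hpj⟩ := mem_iUnion₂.1 hp
    refine ⟨P ∩ closedCell ε k ×ˢ univ ∪ pixel ε k j,
      union_subset hsub (subset_biUnion_of_mem (u := fun j => pixel ε k j) ⟨q, hqj, hqP⟩),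
      Or.inl hd, Or.inr hpj, ?_⟩
    exact IsPreconnected.union q ⟨hqP, hqj.1, trivial⟩ hqj hD.isPreconnected
      ((convex_Icc _ _).prod (convex_Icc _ _)).isPreconnected

section Family

variable {ι : Type*} {P : ι → Set (ℝ × ℝ)}

lemma overlap_strip_of_overlap_fiber {ε : ℝ} (hε : 0 < ε) {k : ℤ} {x : ℝ}
    (hx : x ∈ closedCell ε k) {i j : ι} (h : Overlap (fun i => fiber (P i) x) i j) :
    Overlap (fun i => strip ε (P i) k) i j := by
  obtain ⟨y, hi, hj⟩ := h
  exact ⟨(x, y), mem_strip hε hi hx, mem_strip hε hj hx⟩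

lemma exists_near_of_overlap_strip {ε : ℝ} {k : ℤ} {i j : ι}
    (h : Overlap (fun i => strip ε (P i) k) i j) :
    ∃ p ∈ P i, ∃ q ∈ P j, p.1 ∈ closedCell ε k ∧ q.1 ∈ closedCell ε k ∧ |p.2 - q.2| ≤ 2 * ε := by
  obtain ⟨z, hi, hj⟩ := h
  obtain ⟨a, ⟨p, hpa, hpP⟩, hza⟩ := mem_iUnion₂.1 hi
  obtain ⟨b, ⟨q, hqb, hqP⟩, hzb⟩ := mem_iUnion₂.1 hj
  refine ⟨p, hpP, q, hqP, hpa.1, hqb.1, ?_⟩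
  have h1 := abs_sub_le_of_mem_closedCell hpa.2 hza.2
  have h2 := abs_sub_le_of_mem_closedCell hzb.2 hqb.2
  linarith [abs_sub_le p.2 z.2 q.2]

lemma isClosed_fiber {P : Set (ℝ × ℝ)} (hP : IsClosed P) (x : ℝ) : IsClosed (fiber P x) :=
  hP.preimage (by fun_prop)

lemma isPreconnected_fiber {P : Set (ℝ × ℝ)} (hP : Convex ℝ P) (x : ℝ) :
    IsPreconnected (fiber P x) := by
  refine Convex.isPreconnected fun y hy z hz a b ha hb hab => ?_
  have := hP hy hz ha hb hab
  have hx : a * x + b * x = x := by rw [← add_mul, hab, one_mul]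
  simpa [fiber, hx] using this

lemma fiber_iUnion (P : ι → Set (ℝ × ℝ)) (x : ℝ) : fiber (⋃ i, P i) x = ⋃ i, fiber (P i) x := by
  ext y; simp [fiber]

variable [Finite ι]

lemma fiberCount_iUnion (hc : ∀ i, IsCompact (P i)) (hP : ∀ i, Convex ℝ (P i)) (x : ℝ) :
    fiberCount (⋃ i, P i) x = overlapCount (Overlap fun i => fiber (P i) x) := by
  rw [← componentCount_iUnion (fun i => isClosed_fiber (hc i).isClosed x)
    (fun i => isPreconnected_fiber (hP i) x), ← fiber_iUnion]
  rfl

lemma componentCount_strip_iUnion (hc : ∀ i, IsCompact (P i)) (hP : ∀ i, Convex ℝ (P i)) {ε : ℝ}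
    (hε : 0 < ε) (k : ℤ) :
    componentCount (strip ε (⋃ i, P i) k) = overlapCount (Overlap fun i => strip ε (P i) k) := by
  rw [strip_iUnion, componentCount_iUnion
    (fun i => isClosed_strip hε (hc i) k) (fun i => isPreconnected_strip hε (hP i) k)]

/-- Near the vertical line over `x₀`, polygons whose pixel columns overlap already overlap on that
line: finitely many compact sets cannot approach each other without meeting. -/
lemma exists_overlap_fiber_of_overlap_strip (hc : ∀ i, IsCompact (P i)) (x₀ : ℝ) :
    ∃ δ > 0, ∀ ε < δ, ∀ k : ℤ, (∀ x ∈ closedCell ε k, |x - x₀| < δ) →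
      ∀ i j, Overlap (fun i => strip ε (P i) k) i j → Overlap (fun i => fiber (P i) x₀) i j := by
  have key : ∀ i j, ∃ δ > 0, ¬ Overlap (fun i => fiber (P i) x₀) i j → ∀ p ∈ P i, ∀ q ∈ P j,
      δ ≤ max (max |p.1 - x₀| |q.1 - x₀|) |p.2 - q.2| := by
    intro i j
    by_cases h : Overlap (fun i => fiber (P i) x₀) i j
    · exact ⟨1, one_pos, fun h' => (h' h).elim⟩
    rcases (P i ×ˢ P j).eq_empty_or_nonempty with he | hne
    · exact ⟨1, one_pos, fun _ p hp q hq => (he.subset (mk_mem_prod hp hq)).elim⟩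
    obtain ⟨⟨p, q⟩, hpq, hmin⟩ := ((hc i).prod (hc j)).exists_isMinOn hne
      (f := fun z : (ℝ × ℝ) × (ℝ × ℝ) =>
        max (max |z.1.1 - x₀| |z.2.1 - x₀|) |z.1.2 - z.2.2|) (by fun_prop)
    refine ⟨_, ?_, fun _ p' hp' q' hq' => hmin (⟨hp', hq'⟩ : (p', q') ∈ P i ×ˢ P j)⟩
    by_contra hle
    have hle := not_lt.1 hle
    simp only [max_le_iff, abs_nonpos_iff, sub_eq_zero] at hle
    obtain ⟨⟨h1, h2⟩, h3⟩ := hle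
    refine h ⟨p.2, ?_, ?_⟩
    · change (x₀, p.2) ∈ P i; rw [← h1]; exact hpq.1
    · change (x₀, p.2) ∈ P j; rw [← h2, h3]; exact hpq.2
  choose δ hδ hkey using key
  -- the factor `2` is the height, in pixels, by which overlapping columns may separate points
  have hev : ∀ᶠ d in 𝓝[>] (0 : ℝ), ∀ i j, 2 * d < δ i j := by
    simp only [eventually_all]
    intro i j
    have : Tendsto (fun d : ℝ => 2 * d) (𝓝[>] 0) (𝓝 0) := by
      have : Tendsto (fun d : ℝ => 2 * d) (𝓝 0) (𝓝 (2 * 0)) := (continuous_const_mul 2).tendsto 0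
      rw [mul_zero] at this
      exact this.mono_left nhdsWithin_le_nhds
    exact this.eventually_lt_const (hδ i j)
  obtain ⟨d, hd, hd0⟩ := (hev.and self_mem_nhdsWithin).exists
  refine ⟨d, hd0, fun ε hε k hk i j hij => ?_⟩
  have hd0 : 0 < d := hd0
  by_contra hno
  obtain ⟨p, hp, q, hq, hpk, hqk, hpq⟩ := exists_near_of_overlap_strip hij
  have h1 := hkey i j hno p hp q hq
  have := hk _ hpk
  have := hk _ hqk
  have : max (max |p.1 - x₀| |q.1 - x₀|) |p.2 - q.2| < δ i j := by
    have := hd i j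
    refine max_lt (max_lt ?_ ?_) ?_ <;> linarith
  exact absurd h1 (not_le.2 this)

end Family

/-! ### Affine germs and the one-sided structure of a family of polygons -/

/-- The value at `t` of the affine function `t ↦ a + b t` coded by the pair `(a, b)`. In the
lexicographic order, such pairs are compared as the functions are for small `t > 0`. -/
def germ (f : ℝ ×ₗ ℝ) (t : ℝ) : ℝ := (ofLex f).1 + (ofLex f).2 * t

lemma germ_toLex (a b t : ℝ) : germ (toLex (a, b)) t = a + b * t := rfl

@[fun_prop]
lemma continuous_germ (f : ℝ ×ₗ ℝ) : Continuous (germ f) := by unfold germ; fun_prop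

lemma tendsto_germ (f : ℝ ×ₗ ℝ) : Tendsto (germ f) (𝓝[>] 0) (𝓝 (ofLex f).1) := by
  have := ((continuous_germ f).tendsto 0).mono_left (nhdsWithin_le_nhds (s := Ioi 0))
  simpa [germ] using this

lemma exists_germ_add_le {f g : ℝ ×ₗ ℝ} (h : f < g) :
    ∃ c > 0, ∀ᶠ t in 𝓝[>] (0 : ℝ), germ f t + c * t ≤ germ g t := by
  rcases Prod.Lex.lt_iff.1 h with h | ⟨h1, h2⟩
  · refine ⟨1, one_pos, ?_⟩
    have : Tendsto (fun t => germ f t + 1 * t) (𝓝[>] 0) (𝓝 ((ofLex f).1 + 1 * 0)) :=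
      (tendsto_germ f).add (((continuous_const_mul 1).tendsto 0).mono_left nhdsWithin_le_nhds)
    rw [mul_zero, add_zero] at this
    filter_upwards [this.eventually_lt (tendsto_germ g) h] with t ht using ht.le
  · refine ⟨(ofLex g).2 - (ofLex f).2, sub_pos.2 h2, .of_forall fun t => ?_⟩
    rw [germ, germ, h1]
    exact le_of_eq (by ring)

lemma eventually_germ_lt_iff (f g : ℝ ×ₗ ℝ) :
    ∀ᶠ t in 𝓝[>] (0 : ℝ), (germ f t < germ g t ↔ f < g) := by
  rcases lt_or_ge f g with h | h
  · obtain ⟨c, hc, h'⟩ := exists_germ_add_le h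
    filter_upwards [h', self_mem_nhdsWithin] with t ht ht0
    have : 0 < c * t := mul_pos hc ht0
    exact iff_of_true (by linarith) h
  · rcases h.eq_or_lt with rfl | h'
    · exact .of_forall fun t => by simp
    · obtain ⟨c, hc, h''⟩ := exists_germ_add_le h'
      filter_upwards [h'', self_mem_nhdsWithin] with t ht ht0
      have : 0 < c * t := mul_pos hc ht0
      exact iff_of_false (by linarith) h.not_gt

lemma eventually_germ_le_iff (f g : ℝ ×ₗ ℝ) :
    ∀ᶠ t in 𝓝[>] (0 : ℝ), (germ f t ≤ germ g t ↔ f ≤ g) := by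
  filter_upwards [eventually_germ_lt_iff g f] with t ht
  rw [← not_lt, ht, not_lt]

/-- The fibers of a half-plane near one side of a line are cut out by at most two affine germs;
the pair `1 ≤ y`, `y ≤ 0` encodes empty fibers. -/
lemma IsClosedHalfPlane.exists_germs {H : Set (ℝ × ℝ)} (hH : IsClosedHalfPlane H) (x₀ σ : ℝ) :
    ∃ L U : Finset (ℝ ×ₗ ℝ), ∀ᶠ t in 𝓝[>] (0 : ℝ), ∀ y, (x₀ + σ * t, y) ∈ H ↔
      (∀ f ∈ L, germ f t ≤ y) ∧ ∀ f ∈ U, y ≤ germ f t := by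
  obtain ⟨a, b, c, -, rfl⟩ := hH
  rcases lt_trichotomy b 0 with hb | rfl | hb
  · refine ⟨{toLex ((c - a * x₀) / b, -(a * σ) / b)}, ∅, .of_forall fun t y => ?_⟩
    have : (c - a * x₀) / b + -(a * σ) / b * t = (c - a * (x₀ + σ * t)) / b := by
      field_simp; ring
    simp only [mem_ofPred_eq, Finset.mem_singleton, forall_eq, germ_toLex, this,
      div_le_iff_of_neg hb, Finset.notMem_empty, false_imp_iff, implies_true, and_true]
    constructor <;> intro h <;> linarith
  · rcases le_or_gt (toLex (a * x₀, a * σ)) (toLex (c, 0)) with h | h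
    · refine ⟨∅, ∅, ?_⟩
      filter_upwards [eventually_germ_le_iff (toLex (a * x₀, a * σ)) (toLex (c, 0))] with t ht y
      have := ht.2 h
      rw [germ_toLex, germ_toLex] at this
      simp only [Finset.notMem_empty, false_imp_iff, implies_true, and_true,
        iff_true]
      linarith
    · refine ⟨{toLex (1, 0)}, {toLex (0, 0)}, ?_⟩
      filter_upwards [eventually_germ_lt_iff (toLex (c, 0)) (toLex (a * x₀, a * σ))] with t ht y
      have := ht.2 h
      rw [germ_toLex, germ_toLex] at this
      simp only [Finset.mem_singleton, forall_eq, germ_toLex]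
      constructor
      · intro h; linarith
      · rintro ⟨h1, h2⟩; linarith
  · refine ⟨∅, {toLex ((c - a * x₀) / b, -(a * σ) / b)}, .of_forall fun t y => ?_⟩
    have : (c - a * x₀) / b + -(a * σ) / b * t = (c - a * (x₀ + σ * t)) / b := by
      field_simp; ring
    simp only [mem_ofPred_eq, Finset.mem_singleton, forall_eq, germ_toLex, this,
      le_div_iff₀ hb, Finset.notMem_empty, false_imp_iff, implies_true, true_and]
    constructor <;> intro h <;> linarith

lemma exists_germs_sInter {F : Set (Set (ℝ × ℝ))} (hF : F.Finite)
    (hH : ∀ H ∈ F, IsClosedHalfPlane H) (x₀ σ : ℝ) :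
    ∃ L U : Finset (ℝ ×ₗ ℝ), ∀ᶠ t in 𝓝[>] (0 : ℝ), ∀ y, (x₀ + σ * t, y) ∈ ⋂₀ F ↔
      (∀ f ∈ L, germ f t ≤ y) ∧ ∀ f ∈ U, y ≤ germ f t := by
  classical
  induction F, hF using Set.Finite.induction_on with
  | empty => exact ⟨∅, ∅, .of_forall fun t y => by simp⟩
  | @insert H F _ _ ih =>
    obtain ⟨L, U, h⟩ := ih fun H hH' => hH H (mem_insert_of_mem _ hH')
    obtain ⟨L', U', h'⟩ := (hH H (mem_insert _ _)).exists_germs x₀ σ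
    refine ⟨L ∪ L', U ∪ U', ?_⟩
    filter_upwards [h, h'] with t ht ht' y
    rw [sInter_insert, mem_inter_iff, ht, ht']
    simp only [Finset.mem_union, or_imp, forall_and]
    tauto

/-- On one side of `x₀` the fibers of a convex polygon are eventually empty, or intervals between
two affine functions. -/
lemma IsConvexPolygon.exists_germs {P : Set (ℝ × ℝ)} (hP : IsConvexPolygon P) (x₀ σ : ℝ) :
    (∀ᶠ t in 𝓝[>] (0 : ℝ), ∀ y, (x₀ + σ * t, y) ∉ P) ∨
      ∃ l u : ℝ ×ₗ ℝ, l ≤ u ∧ ∀ᶠ t in 𝓝[>] (0 : ℝ), ∀ y,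
        (x₀ + σ * t, y) ∈ P ↔ germ l t ≤ y ∧ y ≤ germ u t := by
  obtain ⟨hc, F, hF, hH, rfl⟩ := hP
  obtain ⟨L, U, hLU⟩ := exists_germs_sInter hF hH x₀ σ
  obtain ⟨R, hR⟩ := hc.isBounded.subset_closedBall 0
  have hR' : ∀ x y, (x, y) ∈ ⋂₀ F → |y| ≤ R := fun x y h =>
    (norm_snd_le (x, y)).trans (mem_closedBall_zero_iff.1 (hR h))
  rcases L.eq_empty_or_nonempty with rfl | hL
  · left
    filter_upwards [hLU] with t ht y hy
    -- without a lower constraint the fiber would be unbounded below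
    have hmem := (ht (min y (-R - 1))).2 ⟨by simp, fun f hf =>
      (min_le_left _ _).trans (((ht y).1 hy).2 f hf)⟩
    linarith [min_le_right y (-R - 1), (abs_le.1 (hR' _ _ hmem)).1]
  rcases U.eq_empty_or_nonempty with rfl | hU
  · left
    filter_upwards [hLU] with t ht y hy
    have hmem := (ht (max y (R + 1))).2 ⟨fun f hf =>
      (((ht y).1 hy).1 f hf).trans (le_max_left _ _), by simp⟩
    linarith [le_max_right y (R + 1), (abs_le.1 (hR' _ _ hmem)).2]
  obtain ⟨l, hl, hlmax⟩ := L.exists_max_image id hL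
  obtain ⟨u, hu, humin⟩ := U.exists_min_image id hU
  have hiff : ∀ᶠ t in 𝓝[>] (0 : ℝ), ∀ y,
        (x₀ + σ * t, y) ∈ ⋂₀ F ↔ germ l t ≤ y ∧ y ≤ germ u t := by
    filter_upwards [hLU, (Finset.eventually_all L).2 fun f _ => eventually_germ_le_iff f l,
      (Finset.eventually_all U).2 fun f _ => eventually_germ_le_iff u f] with t ht h1 h2 y
    rw [ht]
    exact ⟨fun h => ⟨h.1 l hl, h.2 u hu⟩, fun h =>
      ⟨fun f hf => ((h1 f hf).2 (hlmax f hf)).trans h.1,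
        fun f hf => h.2.trans ((h2 f hf).2 (humin f hf))⟩⟩
  rcases le_or_gt l u with h | h
  · exact Or.inr ⟨l, u, h, hiff⟩
  · left
    filter_upwards [hiff, eventually_germ_lt_iff u l] with t ht h1 y hy
    have := (ht y).1 hy
    linarith [h1.2 h]

/-- The structure of a family `P` on the side `x₀ + σ t`, `0 < t < δ`, of the line over `x₀`:
the members of `D` have fibers `[germ (l i) t, germ (u i) t]`, the others have empty fibers, the
end points are ordered as the germs are, and the gap between an upper end point and a lower end
point above it is at least `c t`. -/
structure IsSideData {ι : Type*} (P : ι → Set (ℝ × ℝ)) (x₀ σ : ℝ) (D : Set ι) (l u : ι → ℝ ×ₗ ℝ)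
    (c δ : ℝ) : Prop where
  c_pos : 0 < c
  δ_pos : 0 < δ
  mem_iff : ∀ t ∈ Ioo 0 δ, ∀ i y,
    (x₀ + σ * t, y) ∈ P i ↔ i ∈ D ∧ germ (l i) t ≤ y ∧ y ≤ germ (u i) t
  le : ∀ i ∈ D, l i ≤ u i
  lu_iff : ∀ t ∈ Ioo 0 δ, ∀ i j, germ (l i) t ≤ germ (u j) t ↔ l i ≤ u j
  uu_iff : ∀ t ∈ Ioo 0 δ, ∀ i j, germ (u i) t ≤ germ (u j) t ↔ u i ≤ u j
  ll_iff : ∀ t ∈ Ioo 0 δ, ∀ i j, germ (l i) t ≤ germ (l j) t ↔ l i ≤ l j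
  gap : ∀ t ∈ Ioo 0 δ, ∀ i j, u i < l j → germ (u i) t + c * t ≤ germ (l j) t

lemma exists_isSideData {ι : Type*} [Finite ι] {P : ι → Set (ℝ × ℝ)}
    (hP : ∀ i, IsConvexPolygon (P i)) (x₀ σ : ℝ) :
    ∃ D l u c δ, IsSideData P x₀ σ D l u c δ := by
  classical
  have h1 : ∀ i, ∃ (d : Prop) (l u : ℝ ×ₗ ℝ), (d → l ≤ u) ∧ ∀ᶠ t in 𝓝[>] (0 : ℝ), ∀ y,
        (x₀ + σ * t, y) ∈ P i ↔ d ∧ germ l t ≤ y ∧ y ≤ germ u t := by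
    intro i
    rcases (hP i).exists_germs x₀ σ with h | ⟨l, u, hlu, h⟩
    · exact ⟨False, toLex (0, 0), toLex (0, 0), False.elim, by simpa using h⟩
    · exact ⟨True, l, u, fun _ => hlu, by simpa using h⟩
  choose D l u hle hmem using h1
  have h2 : ∀ i j, ∃ c > 0, u i < l j →
      ∀ᶠ t in 𝓝[>] (0 : ℝ), germ (u i) t + c * t ≤ germ (l j) t := by
    intro i j
    by_cases h : u i < l j
    · obtain ⟨c, hc, h'⟩ := exists_germ_add_le h
      exact ⟨c, hc, fun _ => h'⟩
    · exact ⟨1, one_pos, fun h' => (h h').elim⟩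
  choose c hc hgap using h2
  have h3 : ∀ᶠ d in 𝓝[>] (0 : ℝ), ∀ i j, d < c i j := by
    simp only [eventually_all]
    exact fun i j => nhdsWithin_le_nhds (Iio_mem_nhds (hc i j))
  obtain ⟨d, hd, hd0⟩ := (h3.and self_mem_nhdsWithin).exists
  have hev : ∀ᶠ t in 𝓝[>] (0 : ℝ),
      (∀ i y, (x₀ + σ * t, y) ∈ P i ↔ D i ∧ germ (l i) t ≤ y ∧ y ≤ germ (u i) t) ∧
      (∀ i j, germ (l i) t ≤ germ (u j) t ↔ l i ≤ u j) ∧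
      (∀ i j, germ (u i) t ≤ germ (u j) t ↔ u i ≤ u j) ∧
      (∀ i j, germ (l i) t ≤ germ (l j) t ↔ l i ≤ l j) ∧
      (∀ i j, u i < l j → germ (u i) t + d * t ≤ germ (l j) t) := by
    refine (eventually_all.2 hmem).and (.and ?_ (.and ?_ (.and ?_ ?_))) <;>
      refine eventually_all.2 fun i => eventually_all.2 fun j => ?_
    · exact eventually_germ_le_iff _ _
    · exact eventually_germ_le_iff _ _
    · exact eventually_germ_le_iff _ _
    · refine eventually_imp_distrib_left.2 fun h => ?_
      filter_upwards [hgap i j h, self_mem_nhdsWithin] with t ht ht0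
      linarith [mul_le_mul_of_nonneg_right (hd i j).le (le_of_lt ht0)]
  obtain ⟨δ, hδ, hsub⟩ := mem_nhdsGT_iff_exists_Ioo_subset.1 hev
  exact ⟨{i | D i}, l, u, d, δ, hd0, hδ, fun t ht => (hsub ht).1, hle,
    fun t ht => (hsub ht).2.1, fun t ht => (hsub ht).2.2.1, fun t ht => (hsub ht).2.2.2.1,
    fun t ht => (hsub ht).2.2.2.2⟩

/-- The overlap relation of the fibers at points close to `x₀` on one side of it. -/
def sideRel {ι : Type*} (D : Set ι) (l u : ι → ℝ ×ₗ ℝ) (i j : ι) : Prop :=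
  i ∈ D ∧ j ∈ D ∧ l i ≤ u j ∧ l j ≤ u i

namespace IsSideData

variable {ι : Type*} {P : ι → Set (ℝ × ℝ)} {x₀ σ : ℝ} {D : Set ι} {l u : ι → ℝ ×ₗ ℝ}
  {c δ : ℝ}

lemma overlap_fiber_eq (h : IsSideData P x₀ σ D l u c δ) {t : ℝ} (ht : t ∈ Ioo 0 δ) :
    Overlap (fun i => fiber (P i) (x₀ + σ * t)) = sideRel D l u := by
  ext i j
  constructor
  · rintro ⟨y, hi, hj⟩
    obtain ⟨hi, hi1, hi2⟩ := (h.mem_iff t ht i y).1 hi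
    obtain ⟨hj, hj1, hj2⟩ := (h.mem_iff t ht j y).1 hj
    exact ⟨hi, hj, (h.lu_iff t ht i j).1 (hi1.trans hj2), (h.lu_iff t ht j i).1 (hj1.trans hi2)⟩
  · rintro ⟨hi, hj, hij, hji⟩
    have hii := (h.lu_iff t ht i i).2 (h.le i hi)
    have hjj := (h.lu_iff t ht j j).2 (h.le j hj)
    have hij := (h.lu_iff t ht i j).2 hij
    have hji := (h.lu_iff t ht j i).2 hji
    exact ⟨max (germ (l i) t) (germ (l j) t),
      (h.mem_iff t ht i _).2 ⟨hi, le_max_left _ _, max_le hii hji⟩,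
      (h.mem_iff t ht j _).2 ⟨hj, le_max_right _ _, max_le hij hjj⟩⟩

lemma u_mem (h : IsSideData P x₀ σ D l u c δ) {t : ℝ} (ht : t ∈ Ioo 0 δ) {i : ι} (hi : i ∈ D) :
    (x₀ + σ * t, germ (u i) t) ∈ P i :=
  (h.mem_iff t ht i _).2 ⟨hi, (h.lu_iff t ht i i).2 (h.le i hi), le_rfl⟩

lemma l_mem (h : IsSideData P x₀ σ D l u c δ) {t : ℝ} (ht : t ∈ Ioo 0 δ) {i : ι} (hi : i ∈ D) :
    (x₀ + σ * t, germ (l i) t) ∈ P i :=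
  (h.mem_iff t ht i _).2 ⟨hi, le_rfl, (h.lu_iff t ht i i).2 (h.le i hi)⟩

lemma tendsto_germ_graph (x₀ σ : ℝ) (f : ℝ ×ₗ ℝ) :
    Tendsto (fun t => (x₀ + σ * t, germ f t)) (𝓝[>] 0) (𝓝 (x₀, (ofLex f).1)) := by
  refine Tendsto.prodMk_nhds ?_ (tendsto_germ f)
  have : Tendsto (fun t => x₀ + σ * t) (𝓝 0) (𝓝 (x₀ + σ * 0)) := by
    refine Continuous.tendsto (by fun_prop) 0
  rw [mul_zero, add_zero] at this
  exact this.mono_left nhdsWithin_le_nhds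

lemma eventually_Ioo (h : IsSideData P x₀ σ D l u c δ) : ∀ᶠ t in 𝓝[>] (0 : ℝ), t ∈ Ioo 0 δ :=
  Ioo_mem_nhdsGT h.δ_pos

lemma u_fst_mem (h : IsSideData P x₀ σ D l u c δ) (hc : ∀ i, IsCompact (P i)) {i : ι}
    (hi : i ∈ D) : (x₀, (ofLex (u i)).1) ∈ P i :=
  (hc i).isClosed.mem_of_tendsto (tendsto_germ_graph x₀ σ (u i))
    (h.eventually_Ioo.mono fun _ ht => h.u_mem ht hi)

lemma l_fst_mem (h : IsSideData P x₀ σ D l u c δ) (hc : ∀ i, IsCompact (P i)) {i : ι}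
    (hi : i ∈ D) : (x₀, (ofLex (l i)).1) ∈ P i :=
  (hc i).isClosed.mem_of_tendsto (tendsto_germ_graph x₀ σ (l i))
    (h.eventually_Ioo.mono fun _ ht => h.l_mem ht hi)

lemma mem_of_overlap_strip (h : IsSideData P x₀ σ D l u c δ) {ε : ℝ} {k : ℤ}
    (hk : ∀ x ∈ closedCell ε k, ∃ t ∈ Ioo 0 δ, x = x₀ + σ * t) {i j : ι}
    (hij : Overlap (fun i => strip ε (P i) k) i j) : i ∈ D := by
  obtain ⟨p, hp, -, -, hpk, -, -⟩ := exists_near_of_overlap_strip hij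
  obtain ⟨t, ht, hpt⟩ := hk _ hpk
  have : (x₀ + σ * t, p.2) ∈ P i := by rw [← hpt]; exact hp
  exact ((h.mem_iff t ht i _).1 this).1

/-- A column at distance at least `ν ε` on one side of `x₀` sees exactly the overlaps of the nearby
fibers: disjoint fibers are then at distance more than `2 ε`. -/
lemma exists_overlap_strip_eq [Finite ι] (h : IsSideData P x₀ σ D l u c δ) (hσ : |σ| = 1) :
    ∃ ν : ℕ, ∀ ε > 0, ∀ k : ℤ, (∀ x ∈ closedCell ε k, ∃ t ∈ Ioo 0 δ, x = x₀ + σ * t) →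
      ∀ x ∈ closedCell ε k, (ν : ℝ) * ε ≤ |x - x₀| →
        Overlap (fun i => strip ε (P i) k) = sideRel D l u := by
  have hν : ∀ᶠ ν : ℕ in atTop, ∀ i, 2 + |(ofLex (u i)).2| < c * ((ν : ℝ) - 1) := by
    refine eventually_all.2 fun i => ?_
    have : Tendsto (fun ν : ℕ => c * ((ν : ℝ) - 1)) atTop atTop :=
      (tendsto_atTop_add_const_right atTop (-1) tendsto_natCast_atTop_atTop).const_mul_atTop
        h.c_pos
    exact this.eventually_gt_atTop _
  obtain ⟨ν, hν⟩ := hν.exists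
  refine ⟨ν, fun ε hε k hk x hx hxν => ?_⟩
  -- a member lying strictly below another one keeps its distance throughout the column
  have key : ∀ i j, u i < l j → ∀ p ∈ P i, ∀ q ∈ P j, p.1 ∈ closedCell ε k →
      q.1 ∈ closedCell ε k → 2 * ε < q.2 - p.2 := by
    intro i j hij p hp q hq hpk hqk
    obtain ⟨s, hs, hps⟩ := hk _ hpk
    obtain ⟨t, ht, hqt⟩ := hk _ hqk
    have hp' : (x₀ + σ * s, p.2) ∈ P i := by rw [← hps]; exact hp
    have hq' : (x₀ + σ * t, q.2) ∈ P j := by rw [← hqt]; exact hq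
    have h1 := ((h.mem_iff s hs i _).1 hp').2.2
    have h2 := ((h.mem_iff t ht j _).1 hq').2.1
    have h3 := h.gap t ht i j hij
    have hst : |s - t| ≤ ε := by
      have := abs_sub_le_of_mem_closedCell hpk hqk
      rwa [hps, hqt, add_sub_add_left_eq_sub, ← mul_sub, abs_mul, hσ, one_mul] at this
    have hνt : ((ν : ℝ) - 1) * ε ≤ t := by
      have h4 := abs_sub_le_of_mem_closedCell hx hqk
      have h5 : |q.1 - x₀| = t := by
        rw [hqt, add_sub_cancel_left, abs_mul, hσ, one_mul, abs_of_pos ht.1]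
      linarith [abs_sub_le x q.1 x₀]
    have h6 : germ (u i) s - germ (u i) t ≤ |(ofLex (u i)).2| * ε := by
      have : germ (u i) s - germ (u i) t = (ofLex (u i)).2 * (s - t) := by
        simp only [germ]; ring
      rw [this]
      refine (le_abs_self _).trans ?_
      rw [abs_mul]
      exact mul_le_mul_of_nonneg_left hst (abs_nonneg _)
    have h7 := mul_le_mul_of_nonneg_left hνt h.c_pos.le
    have h8 := mul_lt_mul_of_pos_right (hν i) hε
    nlinarith
  ext i j
  constructor
  · intro hij
    have hi := h.mem_of_overlap_strip hk hij
    have hj := h.mem_of_overlap_strip hk (i := j) (j := i) (by rwa [Overlap, inter_comm])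
    obtain ⟨p, hp, q, hq, hpk, hqk, hpq⟩ := exists_near_of_overlap_strip hij
    rw [abs_le] at hpq
    refine ⟨hi, hj, ?_, ?_⟩
    · by_contra hlt
      linarith [key j i (not_le.1 hlt) q hq p hp hqk hpk]
    · by_contra hlt
      linarith [key i j (not_le.1 hlt) p hp q hq hpk hqk]
  · intro hij
    obtain ⟨t, ht, rfl⟩ := hk x hx
    rw [← h.overlap_fiber_eq ht] at hij
    exact overlap_strip_of_overlap_fiber hε hx hij

end IsSideData

/-! ### Vertices forced by a change of the components of the fibers -/

lemma closedDisk_mem_nhds (p : ℝ × ℝ) {r : ℝ} (hr : 0 < r) : closedDisk p r ∈ 𝓝 p := by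
  have hc : Continuous fun q : ℝ × ℝ => (q.1 - p.1) ^ 2 + (q.2 - p.2) ^ 2 := by fun_prop
  have : ∀ᶠ q in 𝓝 p, (q.1 - p.1) ^ 2 + (q.2 - p.2) ^ 2 < r ^ 2 :=
    hc.tendsto p |>.eventually_lt_const (by simpa using by positivity)
  exact this.mono fun q hq => hq.le

lemma exists_closedDisk_subset {p : ℝ × ℝ} {s : Set (ℝ × ℝ)} (hs : s ∈ 𝓝 p) :
    ∀ᶠ r in 𝓝[>] (0 : ℝ), closedDisk p r ⊆ s := by
  obtain ⟨e, he, hsub⟩ := Metric.mem_nhds_iff.1 hs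
  filter_upwards [Ioo_mem_nhdsGT he] with r hr q hq
  refine hsub ?_
  have hq : (q.1 - p.1) ^ 2 + (q.2 - p.2) ^ 2 ≤ r ^ 2 := hq
  have h1 : |q.1 - p.1| ≤ r := abs_le_of_sq_le_sq (by nlinarith [sq_nonneg (q.2 - p.2)]) hr.1.le
  have h2 : |q.2 - p.2| ≤ r := abs_le_of_sq_le_sq (by nlinarith [sq_nonneg (q.1 - p.1)]) hr.1.le
  rw [Metric.mem_ball, Prod.dist_eq, Real.dist_eq, Real.dist_eq]
  exact (max_le h1 h2).trans_lt hr.2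

/-- A boundary point is a vertex if arbitrarily close to it there are two boundary points not
collinear with it. -/
lemma isVertex_of_noncollinear {S : Set (ℝ × ℝ)} {p : ℝ × ℝ} (hp : p ∈ frontier S)
    (h : ∀ r > 0, ∃ q ∈ frontier S ∩ closedDisk p r, ∃ q' ∈ frontier S ∩ closedDisk p r,
      (q.1 - p.1) * (q'.2 - p.2) - (q.2 - p.2) * (q'.1 - p.1) ≠ 0) : IsVertex S p := by
  refine ⟨hp, ?_⟩
  filter_upwards [self_mem_nhdsWithin] with r hr
  rintro ⟨a, b, -, hpab, heq⟩
  obtain ⟨q, hq, q', hq', hdet⟩ := h r hr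
  rw [heq, segment_eq_image'] at hq hq'
  have hp' := openSegment_subset_segment ℝ a b hpab
  rw [segment_eq_image'] at hp'
  obtain ⟨x, -, rfl⟩ := hp'
  obtain ⟨y, -, rfl⟩ := hq
  obtain ⟨z, -, rfl⟩ := hq'
  refine hdet ?_
  simp only [Prod.fst_add, Prod.snd_add, Prod.smul_fst, Prod.smul_snd, Prod.fst_sub, Prod.snd_sub,
    smul_eq_mul]
  ring

/-- A boundary point `p` is a vertex if near `p` the closed set `S` lies weakly on one side of the
vertical line through `p`, and on this line weakly above `p`. -/
lemma isVertex_of_extreme {S : Set (ℝ × ℝ)} (hS : IsClosed S) {p : ℝ × ℝ} {σ : ℝ} (hσ : σ ≠ 0)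
    (hp : p ∈ frontier S)
    (h : ∀ᶠ q in 𝓝 p, q ∈ S → σ * (q.1 - p.1) ≤ 0 ∧ (q.1 = p.1 → p.2 ≤ q.2)) :
    IsVertex S p := by
  refine ⟨hp, ?_⟩
  filter_upwards [exists_closedDisk_subset h] with r hr
  rintro ⟨a, b, hab, ⟨x, y, hx, hy, hxy, rfl⟩, heq⟩
  have ha := heq.symm.subset (left_mem_segment ℝ a b)
  have hb := heq.symm.subset (right_mem_segment ℝ a b)
  obtain ⟨ha1, ha2⟩ := hr ha.2 (hS.frontier_subset ha.1)
  obtain ⟨hb1, hb2⟩ := hr hb.2 (hS.frontier_subset hb.1)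
  simp only [Prod.fst_add, Prod.snd_add, Prod.smul_fst, Prod.smul_snd, smul_eq_mul] at *
  obtain rfl : x = 1 - y := by linarith
  -- both end points lie on the vertical line, hence at the height of `p`
  have h1 : b.1 = a.1 := by
    have e1 : y * (σ * (a.1 - b.1)) ≤ 0 := by linarith
    have e2 : (1 - y) * (σ * (b.1 - a.1)) ≤ 0 := by linarith
    have e3 := nonpos_of_mul_nonpos_right e1 hy
    have e4 := nonpos_of_mul_nonpos_right e2 hx
    have e5 : σ * (b.1 - a.1) = 0 := by linarith
    linarith [(mul_eq_zero.1 e5).resolve_left hσ]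
  have ha2 := ha2 (by rw [h1]; ring)
  have hb2 := hb2 (by rw [h1]; ring)
  have e1 : y * (b.2 - a.2) ≤ 0 := by linarith
  have e2 : (1 - y) * (a.2 - b.2) ≤ 0 := by linarith
  have e3 := nonpos_of_mul_nonpos_right e1 hy
  have e4 := nonpos_of_mul_nonpos_right e2 hx
  exact hab (Prod.ext h1.symm (by linarith))

lemma mem_frontier_of_mem_closure_compl {S : Set (ℝ × ℝ)} {p : ℝ × ℝ} (hp : p ∈ S)
    (hp' : p ∈ closure Sᶜ) : p ∈ frontier S := by
  rw [frontier_eq_closure_inter_closure]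
  exact ⟨subset_closure hp, hp'⟩

namespace IsSideData

variable {ι : Type*} [Finite ι] {P : ι → Set (ℝ × ℝ)} {x₀ σ : ℝ} {D : Set ι} {l u : ι → ℝ ×ₗ ℝ}
  {c δ : ℝ}

/-- If a gap between two members on one side of `x₀` closes up over `x₀`, then its lower corner is
a vertex: it is a limit of the lower edge of the gap, and also either of the upper edge or of points
of the vertical segment into which the gap shrinks. -/
lemma exists_vertex_of_gap (h : IsSideData P x₀ σ D l u c δ) (hσ : σ ≠ 0)
    {i j : ι} (hi : i ∈ D) (hj : j ∈ D) {s y : ℝ} (hs : s ∈ Ioo 0 δ)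
    (hiy : germ (u i) s < y) (hjy : y < germ (l j) s) (hy : (x₀ + σ * s, y) ∉ ⋃ n, P n)
    (hfill : ∀ z, (ofLex (u i)).1 ≤ z → z ≤ (ofLex (l j)).1 → (x₀, z) ∈ ⋃ n, P n) :
    ∃ p : ℝ × ℝ, p.1 = x₀ ∧ IsVertex (⋃ n, P n) p ∧
      p ∈ closure {q ∈ ⋃ n, P n | 0 < σ * (q.1 - x₀)} := by
  -- the members of the family bounding the gap around `y` from below and from above
  obtain ⟨k, ⟨hkD, hky⟩, hk⟩ := exists_max_image {n | n ∈ D ∧ germ (u n) s < y} u (toFinite _)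
    ⟨i, hi, hiy⟩
  obtain ⟨m, ⟨hmD, hmy⟩, hm⟩ := exists_min_image {n | n ∈ D ∧ y < germ (l n) s} l (toFinite _)
    ⟨j, hj, hjy⟩
  have hkm : u k < l m := by
    rw [← not_le, ← h.lu_iff s hs, not_le]
    exact hky.trans hmy
  have hlt : ∀ t ∈ Ioo 0 δ, germ (u k) t < germ (l m) t := by
    intro t ht
    rw [← not_le, h.lu_iff t ht, not_le]
    exact hkm
  have hgap : ∀ t ∈ Ioo 0 δ, ∀ z ∈ Ioo (germ (u k) t) (germ (l m) t),
      (x₀ + σ * t, z) ∈ (⋃ n, P n)ᶜ := by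
    intro t ht z hz hzS
    obtain ⟨n, hn⟩ := mem_iUnion.1 hzS
    obtain ⟨hnD, hn1, hn2⟩ := (h.mem_iff t ht n z).1 hn
    rcases lt_or_ge (germ (u n) s) y with h1 | h1
    · have := (h.uu_iff t ht n k).2 (hk n ⟨hnD, h1⟩)
      linarith [hz.1]
    rcases lt_or_ge y (germ (l n) s) with h2 | h2
    · have := (h.ll_iff t ht m n).2 (hm n ⟨hnD, h2⟩)
      linarith [hz.2]
    · exact hy (mem_iUnion_of_mem n ((h.mem_iff s hs n y).2 ⟨hnD, h2, h1⟩))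
  have hcl : ∀ t ∈ Ioo 0 δ, ∀ z ∈ Icc (germ (u k) t) (germ (l m) t),
      (x₀ + σ * t, z) ∈ closure (⋃ n, P n)ᶜ := by
    intro t ht z hz
    rw [← closure_Ioo (hlt t ht).ne] at hz
    exact map_mem_closure (f := fun z => (x₀ + σ * t, z)) (by fun_prop) hz (hgap t ht)
  have hu : ∀ t ∈ Ioo 0 δ, (x₀ + σ * t, germ (u k) t) ∈ frontier (⋃ n, P n) := fun t ht =>
    mem_frontier_of_mem_closure_compl (mem_iUnion_of_mem k (h.u_mem ht hkD))
      (hcl t ht _ ⟨le_rfl, (hlt t ht).le⟩)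
  have hl : ∀ t ∈ Ioo 0 δ, (x₀ + σ * t, germ (l m) t) ∈ frontier (⋃ n, P n) := fun t ht =>
    mem_frontier_of_mem_closure_compl (mem_iUnion_of_mem m (h.l_mem ht hmD))
      (hcl t ht _ ⟨(hlt t ht).le, le_rfl⟩)
  have hvert : ∀ z, (ofLex (u k)).1 ≤ z → z ≤ (ofLex (l m)).1 →
      (x₀, z) ∈ frontier (⋃ n, P n) := by
    intro z hz1 hz2
    refine mem_frontier_of_mem_closure_compl (hfill z (le_trans ?_ hz1) (hz2.trans ?_)) ?_
    · exact Prod.Lex.monotone_fst_ofLex (hk i ⟨hi, hiy⟩)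
    · exact Prod.Lex.monotone_fst_ofLex (hm j ⟨hj, hjy⟩)
    · have hlim : Tendsto (fun t => (x₀ + σ * t, max (germ (u k) t) (min z (germ (l m) t))))
          (𝓝[>] 0) (𝓝 (x₀, z)) := by
        have h1 := (tendsto_germ (u k)).max
          ((tendsto_const_nhds (x := z)).min (tendsto_germ (l m)))
        rw [min_eq_left hz2, max_eq_right hz1] at h1
        exact ((continuous_fst.tendsto _).comp (tendsto_germ_graph x₀ σ (u k))).prodMk_nhds h1
      exact isClosed_closure.mem_of_tendsto hlim (h.eventually_Ioo.mono fun t ht =>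
        hcl t ht _ ⟨le_max_left _ _, max_le (hlt t ht).le (min_le_right _ _)⟩)
  have hle : (ofLex (u k)).1 ≤ (ofLex (l m)).1 := Prod.Lex.monotone_fst_ofLex hkm.le
  refine ⟨(x₀, (ofLex (u k)).1), rfl, isVertex_of_noncollinear (hvert _ le_rfl hle) ?_, ?_⟩
  · intro r hr
    have hdu := tendsto_germ_graph x₀ σ (u k) (closedDisk_mem_nhds _ hr)
    rcases hle.lt_or_eq with hlt' | heq
    · obtain ⟨t, ht, htd⟩ := (h.eventually_Ioo.and hdu).exists
      refine ⟨_, ⟨hu t ht, htd⟩, (x₀, (ofLex (u k)).1 + min r ((ofLex (l m)).1 - (ofLex (u k)).1)),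
        ⟨hvert _ ?_ ?_, ?_⟩, ?_⟩
      · linarith [le_min hr.le (sub_nonneg.2 hle)]
      · linarith [min_le_right r ((ofLex (l m)).1 - (ofLex (u k)).1)]
      · have h0 := le_min hr.le (sub_nonneg.2 hle)
        have h1 := min_le_left r ((ofLex (l m)).1 - (ofLex (u k)).1)
        simp only [closedDisk, mem_ofPred_eq, sub_self, add_sub_cancel_left]
        nlinarith
      · have h0 := lt_min hr (sub_pos.2 hlt')
        simp only [sub_self, add_sub_cancel_left, mul_zero, sub_zero]
        exact mul_ne_zero (mul_ne_zero hσ ht.1.ne') h0.ne'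
    · have hdl := tendsto_germ_graph x₀ σ (l m) (by rw [← heq]; exact closedDisk_mem_nhds _ hr)
      obtain ⟨t, ⟨ht, htu⟩, htl⟩ := ((h.eventually_Ioo.and hdu).and hdl).exists
      refine ⟨_, ⟨hu t ht, htu⟩, _, ⟨hl t ht, htl⟩, ?_⟩
      have h1 := mul_ne_zero (mul_ne_zero hσ ht.1.ne') (sub_pos.2 (hlt t ht)).ne'
      convert h1 using 1
      dsimp only
      ring
  · refine mem_closure_of_tendsto (tendsto_germ_graph x₀ σ (u k))
      (h.eventually_Ioo.mono fun t ht => ⟨mem_iUnion_of_mem k (h.u_mem ht hkD), ?_⟩)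
    dsimp only
    rw [add_sub_cancel_left, ← mul_assoc]
    exact mul_pos (mul_self_pos.2 hσ) ht.1

/-- If two components of the fibers on one side merge over `x₀`, there is a vertex over `x₀` that is
a limit of points of the union on that side. -/
lemma exists_vertex_of_merge (h : IsSideData P x₀ σ D l u c δ) (hσ : σ ≠ 0)
    (hc : ∀ i, IsCompact (P i)) (hP : ∀ i, Convex ℝ (P i)) {s : ℝ} (hs : s ∈ Ioo 0 δ)
    {i j : {i // Overlap (fun i => fiber (P i) (x₀ + σ * s)) i i}}
    (hne : overlapClass _ i ≠ overlapClass _ j) {hi : Overlap (fun i => fiber (P i) x₀) i i}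
    {hj : Overlap (fun i => fiber (P i) x₀) j j}
    (heq : overlapClass (fun i => fiber (P i) x₀) ⟨i, hi⟩ =
      overlapClass (fun i => fiber (P i) x₀) ⟨j, hj⟩) :
    ∃ p : ℝ × ℝ, p.1 = x₀ ∧ IsVertex (⋃ n, P n) p ∧
      p ∈ closure {q ∈ ⋃ n, P n | 0 < σ * (q.1 - x₀)} := by
  obtain ⟨yi, hyi⟩ := i.2.nonempty
  obtain ⟨yj, hyj⟩ := j.2.nonempty
  wlog hle : yi ≤ yj generalizing i j yi yj
  · exact this hne.symm heq.symm yj hyj yi hyi (not_le.1 hle).le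
  obtain ⟨hiD, hi1, hi2⟩ := (h.mem_iff s hs i yi).1 hyi
  obtain ⟨hjD, hj1, hj2⟩ := (h.mem_iff s hs j yj).1 hyj
  obtain ⟨y, hy, hyS⟩ : ∃ y ∈ Icc yi yj, (x₀ + σ * s, y) ∉ ⋃ n, P n := by
    by_contra! hno
    refine hne (overlapClass_eq_of_isPreconnected (fun n => isClosed_fiber (hc n).isClosed _)
      isPreconnected_Icc (fun y hy => ?_) ⟨yi, ⟨le_rfl, hle⟩, hyi⟩ ⟨yj, ⟨hle, le_rfl⟩, hyj⟩)
    rw [← fiber_iUnion]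
    exact hno y hy
  refine h.exists_vertex_of_gap hσ hiD hjD hs (y := y) ?_ ?_ hyS ?_
  · by_contra hlt
    exact hyS (mem_iUnion_of_mem _ ((h.mem_iff s hs i y).2 ⟨hiD, hi1.trans hy.1, not_lt.1 hlt⟩))
  · by_contra hlt
    exact hyS (mem_iUnion_of_mem _ ((h.mem_iff s hs j y).2 ⟨hjD, not_lt.1 hlt, hy.2.trans hj2⟩))
  · intro z hz1 hz2
    obtain ⟨C, hCS, hC, hiC, hjC⟩ :=
      exists_isPreconnected_of_overlapClass_eq (fun n => isPreconnected_fiber (hP n) x₀) heq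
    have := hCS (hC.ordConnected.out (hiC (h.u_fst_mem hc hiD)) (hjC (h.l_fst_mem hc hjD))
      ⟨hz1, hz2⟩)
    rwa [← fiber_iUnion] at this

/-- If a component of the fiber over `x₀` meets no member that continues to one side, its lowest
point is a vertex and not a limit of points of the union on that side. -/
lemma exists_vertex_of_birth (h : IsSideData P x₀ σ D l u c δ) (hσ : σ ≠ 0)
    (hc : ∀ i, IsCompact (P i)) (i : {i // Overlap (fun i => fiber (P i) x₀) i i})
    (hnew : ∀ k : {i // Overlap (fun i => fiber (P i) x₀) i i}, k.1 ∈ D →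
      overlapClass _ k ≠ overlapClass _ i) :
    ∃ p : ℝ × ℝ, p.1 = x₀ ∧ IsVertex (⋃ n, P n) p ∧
      p ∉ closure {q ∈ ⋃ n, P n | 0 < σ * (q.1 - x₀)} := by
  let T := fun i => fiber (P i) x₀
  have hScl : IsClosed (⋃ n, P n) := isClosed_iUnion_of_finite fun n => (hc n).isClosed
  have hcomp : IsCompact (⋃ k : {k : {i // Overlap T i i} // overlapClass T k = overlapClass T i},
      P k ∩ {q | q.1 = x₀}) :=
    isCompact_iUnion fun k => (hc _).inter_right (isClosed_eq continuous_fst continuous_const)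
  obtain ⟨y, hy⟩ := i.2.nonempty
  obtain ⟨p, hp, hmin⟩ := hcomp.exists_isMinOn
    ⟨(x₀, y), mem_iUnion_of_mem ⟨i, rfl⟩ ⟨hy, rfl⟩⟩ continuous_snd.continuousOn
  obtain ⟨k₀, hpk₀, hpx⟩ := mem_iUnion.1 hp
  have hpx : p.1 = x₀ := hpx
  have hpT : ∀ k, p ∈ P k → p.2 ∈ T k := by
    intro k hk
    change (x₀, p.2) ∈ P k
    rw [← hpx]; exact hk
  have hclass : ∀ k, ∀ hk : p ∈ P k,
      overlapClass T ⟨k, overlap_self_of_mem (hpT k hk)⟩ = overlapClass T i := fun k hk =>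
    (overlapClass_eq_of_overlap ⟨p.2, hpT k hk, hpT k₀ hpk₀⟩).trans k₀.2
  have hnear : ∀ᶠ q in 𝓝 p, ∀ k, q ∈ P k → p ∈ P k := by
    refine eventually_all.2 fun k => ?_
    by_cases hk : p ∈ P k
    · exact .of_forall fun _ _ => hk
    · filter_upwards [(hc k).isClosed.isOpen_compl.mem_nhds hk] with q hq hq' using (hq hq').elim
  have hside : ∀ᶠ q : ℝ × ℝ in 𝓝 p, (q.1 - x₀) / σ < δ := by
    have : Tendsto (fun q : ℝ × ℝ => (q.1 - x₀) / σ) (𝓝 p) (𝓝 ((p.1 - x₀) / σ)) :=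
      Continuous.tendsto (by fun_prop) p
    rw [hpx, sub_self, zero_div] at this
    exact this.eventually_lt_const h.δ_pos
  have hloc : ∀ᶠ q in 𝓝 p, q ∈ ⋃ n, P n → σ * (q.1 - p.1) ≤ 0 ∧ (q.1 = p.1 → p.2 ≤ q.2) := by
    filter_upwards [hnear, hside] with q hq1 hq2 hqS
    obtain ⟨k, hk⟩ := mem_iUnion.1 hqS
    have hpk := hq1 k hk
    rw [hpx]
    constructor
    · by_contra hpos
      have ht : 0 < (q.1 - x₀) / σ := by
        rw [← mul_pos_iff_of_pos_left (mul_self_pos.2 hσ)]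
        convert not_le.1 hpos using 1
        field_simp
      have hq : (x₀ + σ * ((q.1 - x₀) / σ), q.2) ∈ P k := by
        rwa [mul_div_cancel₀ _ hσ, add_sub_cancel]
      exact hnew _ ((h.mem_iff _ ⟨ht, hq2⟩ _ _).1 hq).1 (hclass k hpk)
    · intro hqx
      exact hmin (mem_iUnion_of_mem ⟨_, hclass k hpk⟩ ⟨hk, hqx⟩)
  refine ⟨p, hpx, isVertex_of_extreme hScl hσ (mem_frontier_of_mem_closure_compl
    (mem_iUnion_of_mem _ hpk₀) ?_) hloc, ?_⟩
  · have hlim := tendsto_germ_graph x₀ σ (toLex (p.2, 0))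
    have hp' : (x₀, (ofLex (toLex (p.2, (0 : ℝ)))).1) = p := Prod.ext hpx.symm rfl
    rw [hp'] at hlim
    refine mem_closure_of_tendsto hlim ?_
    filter_upwards [hlim.eventually hloc, self_mem_nhdsWithin] with t ht ht0 hmem
    have := (ht hmem).1
    rw [hpx, add_sub_cancel_left, ← mul_assoc] at this
    exact absurd (mul_pos (mul_self_pos.2 hσ) ht0) (not_lt.2 this)
  · rw [mem_closure_iff_frequently, not_frequently]
    filter_upwards [hloc] with q hq hq'
    have := (hq hq'.1).1
    rw [hpx] at this
    exact absurd hq'.2 (not_lt.2 this)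

/-- If no two vertices lie over `x₀` and the number of components does not change at `x₀` from one
side, then the columns near `x₀` on that side have the same number of components: otherwise a
merging of components would have to be compensated by the birth of another one, and these produce
two distinct vertices. -/
lemma overlapCount_strip_eq (h : IsSideData P x₀ σ D l u c δ) (hσ : σ ≠ 0)
    (hc : ∀ i, IsCompact (P i)) (hP : ∀ i, Convex ℝ (P i))
    (hgen : ∀ p q : ℝ × ℝ, IsVertex (⋃ n, P n) p → IsVertex (⋃ n, P n) q → p ≠ q → p.1 ≠ q.1)
    {s : ℝ} (hs : s ∈ Ioo 0 δ)
    (hcount : overlapCount (Overlap fun i => fiber (P i) (x₀ + σ * s)) =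
      overlapCount (Overlap fun i => fiber (P i) x₀))
    {ε : ℝ} (hε : 0 < ε) {k : ℤ} (hk : ∀ x ∈ closedCell ε k, ∃ t ∈ Ioo 0 δ, x = x₀ + σ * t)
    (hsk : x₀ + σ * s ∈ closedCell ε k)
    (hnear : ∀ i j, Overlap (fun i => strip ε (P i) k) i j →
      Overlap (fun i => fiber (P i) x₀) i j) :
    overlapCount (Overlap fun i => strip ε (P i) k) =
      overlapCount (Overlap fun i => fiber (P i) (x₀ + σ * s)) := by
  have hsub : ∀ i j, Overlap (fun i => fiber (P i) (x₀ + σ * s)) i j →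
      Overlap (fun i => strip ε (P i) k) i j := fun i j hij =>
    overlap_strip_of_overlap_fiber hε hsk hij
  refine overlapCount_eq_of_between (r' := Overlap fun i => fiber (P i) x₀) hsub hnear ?_ ?_
  · intro i hi
    have hiD := h.mem_of_overlap_strip hk hi
    rw [h.overlap_fiber_eq hs]
    exact ⟨hiD, hiD, h.le i hiD, h.le i hiD⟩
  · intro i j hi hj heq
    by_contra hne
    obtain ⟨p, hp, hpv, hpc⟩ := h.exists_vertex_of_merge hσ hc hP hs (i := ⟨i, hi⟩) (j := ⟨j, hj⟩)
      hne heq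
    let φ := Quot.map (ra := fun i j : {i // Overlap (fun i => fiber (P i) (x₀ + σ * s)) i i} =>
        Overlap (fun i => fiber (P i) (x₀ + σ * s)) i j)
      (rb := fun i j : {i // Overlap (fun i => fiber (P i) x₀) i i} =>
        Overlap (fun i => fiber (P i) x₀) i j)
      (fun i => ⟨i, hnear _ _ (hsub _ _ i.2)⟩) fun i j hij => hnear _ _ (hsub _ _ hij)
    have hφ : ¬ Function.Surjective φ := fun hsurj =>
      hne ((hsurj.bijective_of_nat_card_le hcount.le).injective heq)
    rw [Function.Surjective] at hφ
    push Not at hφ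
    obtain ⟨⟨m⟩, hm⟩ := hφ
    obtain ⟨q, hq, hqv, hqc⟩ := h.exists_vertex_of_birth hσ hc m fun n hn hnm => by
      have hnn : Overlap (fun i => fiber (P i) (x₀ + σ * s)) n n := by
        rw [h.overlap_fiber_eq hs]
        exact ⟨hn, hn, h.le _ hn, h.le _ hn⟩
      exact hm (Quot.mk _ ⟨n, hnn⟩) hnm
    exact hgen p q hpv hqv (fun e => hqc (e ▸ hpc)) (hp.trans hq.symm)

end IsSideData

/-! ### Jumps of the component counter and the noise bound -/

lemma IsConvexPolygon.convex {P : Set (ℝ × ℝ)} (hP : IsConvexPolygon P) : Convex ℝ P := by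
  obtain ⟨-, F, -, hF, rfl⟩ := hP
  refine convex_sInter fun H hH => ?_
  obtain ⟨a, b, c, -, rfl⟩ := hF H hH
  refine convex_halfSpace_le (f := fun p : ℝ × ℝ => a * p.1 + b * p.2) ⟨?_, ?_⟩ c
  · intro p q; simp only [Prod.fst_add, Prod.snd_add]; ring
  · intro r p; simp only [Prod.smul_fst, Prod.smul_snd, smul_eq_mul]; ring

lemma mem_jumpSet_iff {S : Set (ℝ × ℝ)} {x₀ δ : ℝ} {m n : ℕ} (hδ : 0 < δ)
    (hm : ∀ x ∈ Ioo (x₀ - δ) x₀, fiberCount S x = m)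
    (hn : ∀ x ∈ Ioo x₀ (x₀ + δ), fiberCount S x = n) :
    x₀ ∈ jumpSet S ↔ fiberCount S x₀ ≠ m ∨ fiberCount S x₀ ≠ n := by
  have h1 : Tendsto (fiberCount S) (𝓝[<] x₀) (𝓝 m) :=
    tendsto_nhds_of_eventually_eq (mem_of_superset (Ioo_mem_nhdsLT (by linarith)) hm)
  have h2 : Tendsto (fiberCount S) (𝓝[>] x₀) (𝓝 n) :=
    tendsto_nhds_of_eventually_eq (mem_of_superset (Ioo_mem_nhdsGT (by linarith)) hn)
  constructor
  · rintro (⟨a, ha, hne⟩ | ⟨a, ha, hne⟩)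
    · exact Or.inl (tendsto_nhds_unique ha h1 ▸ hne)
    · exact Or.inr (tendsto_nhds_unique ha h2 ▸ hne)
  · rintro (h | h)
    · exact Or.inl ⟨m, h1, h⟩
    · exact Or.inr ⟨n, h2, h⟩

lemma mem_pixelJumpSet {S : Set (ℝ × ℝ)} {ε : ℝ} (hε : 0 < ε) {j : ℤ}
    (h : componentCount (strip ε S j) ≠ componentCount (strip ε S (j + 1))) :
    (j : ℝ) * ε ∈ pixelJumpSet S ε := by
  refine ⟨⟨j, rfl⟩, _, _, tendsto_nhds_of_eventually_eq ?_, tendsto_nhds_of_eventually_eq ?_, h⟩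
  · filter_upwards [Ioo_mem_nhdsLT (by linarith : ((j : ℝ) - 1) * ε < j * ε)] with x hx
    exact stackCount_eq hε hx S
  · filter_upwards [Ioo_mem_nhdsGT (by linarith : (j : ℝ) * ε < (j + 1) * ε)] with x hx
    refine stackCount_eq hε ?_ S
    simpa [cell] using hx

lemma exists_step_ne {f : ℤ → ℕ} (m : ℕ) {a : ℤ} (h : f a ≠ f (a + m)) :
    ∃ j, a ≤ j ∧ j + 1 ≤ a + m ∧ f j ≠ f (j + 1) := by
  induction m with
  | zero => simp at h
  | succ m ih =>
    by_cases h' : f a = f (a + m)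
    · refine ⟨a + m, by omega, by push_cast; omega, ?_⟩
      rw [← h', add_assoc]
      exact_mod_cast h
    · obtain ⟨j, h1, h2, h3⟩ := ih h'
      exact ⟨j, h1, by push_cast; omega, h3⟩

section Family

variable {ι : Type*} [Finite ι] {P : ι → Set (ℝ × ℝ)}

lemma IsSideData.fiberCount_eq {x₀ σ : ℝ} {D : Set ι} {l u : ι → ℝ ×ₗ ℝ} {c δ : ℝ}
    (h : IsSideData P x₀ σ D l u c δ) (hP : ∀ i, IsConvexPolygon (P i)) {t : ℝ}
    (ht : t ∈ Ioo 0 δ) :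
    fiberCount (⋃ i, P i) (x₀ + σ * t) = overlapCount (sideRel D l u) := by
  rw [fiberCount_iUnion (fun i => (hP i).1) (fun i => (hP i).convex), h.overlap_fiber_eq ht]

lemma exists_fiberCount_eq_near (hP : ∀ i, IsConvexPolygon (P i)) (x₀ : ℝ) :
    ∃ δ > 0, ∃ m n : ℕ, (∀ x ∈ Ioo (x₀ - δ) x₀, fiberCount (⋃ i, P i) x = m) ∧
      ∀ x ∈ Ioo x₀ (x₀ + δ), fiberCount (⋃ i, P i) x = n := by
  obtain ⟨D, l, u, c, δ, h⟩ := exists_isSideData hP x₀ (-1)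
  obtain ⟨D', l', u', c', δ', h'⟩ := exists_isSideData hP x₀ 1
  refine ⟨min δ δ', lt_min h.δ_pos h'.δ_pos, overlapCount (sideRel D l u),
    overlapCount (sideRel D' l' u'), fun x hx => ?_, fun x hx => ?_⟩
  · have := h.fiberCount_eq hP (t := x₀ - x)
      ⟨by linarith [hx.2], by linarith [hx.1, min_le_left δ δ']⟩
    rwa [show x₀ + -1 * (x₀ - x) = x by ring] at this
  · have := h'.fiberCount_eq hP (t := x - x₀)
      ⟨by linarith [hx.1], by linarith [hx.2, min_le_right δ δ']⟩
    rwa [show x₀ + 1 * (x - x₀) = x by ring] at this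

lemma exists_fiberCount_eq_of_notMem_jumpSet (hP : ∀ i, IsConvexPolygon (P i)) (x₀ : ℝ) :
    ∃ δ > 0, x₀ ∉ jumpSet (⋃ i, P i) → ∀ x, |x - x₀| < δ →
      fiberCount (⋃ i, P i) x = fiberCount (⋃ i, P i) x₀ := by
  obtain ⟨δ, hδ, m, n, hm, hn⟩ := exists_fiberCount_eq_near hP x₀
  refine ⟨δ, hδ, fun hx₀ x hx => ?_⟩
  rw [mem_jumpSet_iff hδ hm hn] at hx₀
  push Not at hx₀
  rw [abs_lt] at hx
  rcases lt_trichotomy x x₀ with h | rfl | h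
  · rw [hm x ⟨by linarith, h⟩, hx₀.1]
  · rfl
  · rw [hn x ⟨h, by linarith⟩, hx₀.2]

/-- The jumping set is discrete. -/
lemma exists_notMem_jumpSet_near (hP : ∀ i, IsConvexPolygon (P i)) (x₀ : ℝ) :
    ∃ δ > 0, ∀ x ∈ jumpSet (⋃ i, P i), |x - x₀| < δ → x = x₀ := by
  obtain ⟨δ, hδ, m, n, hm, hn⟩ := exists_fiberCount_eq_near hP x₀
  refine ⟨δ, hδ, fun x hx hxδ => ?_⟩
  rw [abs_lt] at hxδ
  by_contra hne
  rcases lt_or_gt_of_ne hne with h | h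
  · have h0 : 0 < min (x - (x₀ - δ)) (x₀ - x) := lt_min (by linarith) (by linarith)
    have h1 := min_le_left (x - (x₀ - δ)) (x₀ - x)
    have h2 := min_le_right (x - (x₀ - δ)) (x₀ - x)
    rw [mem_jumpSet_iff h0 (fun z hz => hm z ⟨by linarith [hz.1], by linarith [hz.2]⟩)
      (fun z hz => hm z ⟨by linarith [hz.1], by linarith [hz.2]⟩), hm x ⟨by linarith, h⟩] at hx
    simp at hx
  · have h0 : 0 < min (x - x₀) (x₀ + δ - x) := lt_min (by linarith) (by linarith)
    have h1 := min_le_left (x - x₀) (x₀ + δ - x)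
    have h2 := min_le_right (x - x₀) (x₀ + δ - x)
    rw [mem_jumpSet_iff h0 (fun z hz => hn z ⟨by linarith [hz.1], by linarith [hz.2]⟩)
      (fun z hz => hn z ⟨by linarith [hz.1], by linarith [hz.2]⟩), hn x ⟨h, by linarith⟩] at hx
    simp at hx

/-- The column over a small cell that contains `x₀` has as many components as the fiber over
`x₀`. -/
lemma exists_componentCount_strip_eq (hP : ∀ i, IsConvexPolygon (P i)) (x₀ : ℝ) :
    ∃ δ > 0, ∀ ε > 0, ε < δ → ∀ k : ℤ, x₀ ∈ closedCell ε k →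
      componentCount (strip ε (⋃ i, P i) k) = fiberCount (⋃ i, P i) x₀ := by
  obtain ⟨δ, hδ, h⟩ := exists_overlap_fiber_of_overlap_strip (fun i => (hP i).1) x₀
  refine ⟨δ, hδ, fun ε hε hεδ k hk => ?_⟩
  rw [componentCount_strip_iUnion (fun i => (hP i).1) (fun i => (hP i).convex) hε,
    fiberCount_iUnion (fun i => (hP i).1) (fun i => (hP i).convex)]
  congr 1
  ext i j
  exact ⟨h ε hεδ k (fun x hx => (abs_sub_le_of_mem_closedCell hx hk).trans_lt hεδ) i j,
    overlap_strip_of_overlap_fiber hε hk⟩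

/-- The noise bound on one side of `x₀`. -/
lemma IsSideData.exists_componentCount_strip_eq {x₀ σ : ℝ} {D : Set ι} {l u : ι → ℝ ×ₗ ℝ} {c δ : ℝ}
    (h : IsSideData P x₀ σ D l u c δ) (hP : ∀ i, IsConvexPolygon (P i)) (hσ : |σ| = 1)
    (hgen : ∀ p q : ℝ × ℝ, IsVertex (⋃ n, P n) p → IsVertex (⋃ n, P n) q → p ≠ q → p.1 ≠ q.1) :
    ∃ r > 0, ∃ ν : ℕ, ∀ ε > 0, ε < r → ∀ k : ℤ,
      (∀ x ∈ closedCell ε k, ∃ t ∈ Ioo 0 r, x = x₀ + σ * t) →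
      ∀ x ∈ closedCell ε k, (x₀ ∈ jumpSet (⋃ i, P i) → (ν : ℝ) * ε ≤ |x - x₀|) →
        componentCount (strip ε (⋃ i, P i) k) = fiberCount (⋃ i, P i) x := by
  have hcpt := fun i => (hP i).1
  have hcvx := fun i => (hP i).convex
  have hσ0 : σ ≠ 0 := by rintro rfl; simp at hσ
  obtain ⟨d, hd, hnear⟩ := exists_overlap_fiber_of_overlap_strip hcpt x₀
  obtain ⟨e, he, hnj⟩ := exists_fiberCount_eq_of_notMem_jumpSet hP x₀
  obtain ⟨ν, hν⟩ := h.exists_overlap_strip_eq hσ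
  refine ⟨min δ (min d e), lt_min h.δ_pos (lt_min hd he), ν, fun ε hε hεr k hk x hx hxν => ?_⟩
  have hk' : ∀ x ∈ closedCell ε k, ∃ t ∈ Ioo 0 δ, x = x₀ + σ * t := fun x hx => by
    obtain ⟨t, ht, rfl⟩ := hk x hx
    exact ⟨t, ⟨ht.1, ht.2.trans_le (min_le_left _ _)⟩, rfl⟩
  have habs : ∀ x ∈ closedCell ε k, |x - x₀| < min d e := fun x hx => by
    obtain ⟨t, ht, rfl⟩ := hk x hx
    rw [add_sub_cancel_left, abs_mul, hσ, one_mul, abs_of_pos ht.1]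
    exact ht.2.trans_le (min_le_right _ _)
  rw [componentCount_strip_iUnion hcpt hcvx hε]
  by_cases hx₀ : x₀ ∈ jumpSet (⋃ i, P i)
  · rw [hν ε hε k hk' x hx (hxν hx₀)]
    obtain ⟨t, ht, rfl⟩ := hk' x hx
    rw [h.fiberCount_eq hP ht]
  · have hcount := hnj hx₀ x ((habs x hx).trans_le (min_le_right _ _))
    obtain ⟨t, ht, rfl⟩ := hk' x hx
    rw [fiberCount_iUnion hcpt hcvx, fiberCount_iUnion hcpt hcvx] at hcount
    rw [fiberCount_iUnion hcpt hcvx]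
    exact h.overlapCount_strip_eq hσ0 hcpt hcvx hgen ht hcount hε hk' hx
      (hnear ε (hεr.trans_le ((min_le_right _ _).trans (min_le_left _ _))) k
        fun x hx => (habs x hx).trans_le (min_le_left _ _))

/-- Every point has a neighborhood with its own noise range. -/
lemma exists_local_noiseBound (hP : ∀ i, IsConvexPolygon (P i))
    (hgen : ∀ p q : ℝ × ℝ, IsVertex (⋃ n, P n) p → IsVertex (⋃ n, P n) q → p ≠ q → p.1 ≠ q.1)
    (x₀ : ℝ) :
    ∃ δ > 0, ∃ ν : ℕ, ∀ ε > 0, ε < δ → ∀ x, IsGenericPoint ε x → |x - x₀| < δ →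
      (x₀ ∈ jumpSet (⋃ i, P i) → (ν : ℝ) * ε ≤ |x - x₀|) →
        stackCount (⋃ i, P i) ε x = fiberCount (⋃ i, P i) x := by
  obtain ⟨d, hd, hcol⟩ := exists_componentCount_strip_eq hP x₀
  obtain ⟨e, he, hnj⟩ := exists_fiberCount_eq_of_notMem_jumpSet hP x₀
  obtain ⟨_, _, _, _, _, hl⟩ := exists_isSideData hP x₀ (-1)
  obtain ⟨_, _, _, _, _, hr⟩ := exists_isSideData hP x₀ 1
  obtain ⟨a, ha, μ, hμ⟩ := hl.exists_componentCount_strip_eq hP (by simp) hgen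
  obtain ⟨b, hb, ν, hν⟩ := hr.exists_componentCount_strip_eq hP (by simp) hgen
  set δ := min (min d e) (min a b) with hδ
  have hδ0 : 0 < δ := lt_min (lt_min hd he) (lt_min ha hb)
  have hδd : δ ≤ d := (min_le_left _ _).trans (min_le_left _ _)
  have hδe : δ ≤ e := (min_le_left _ _).trans (min_le_right _ _)
  have hδa : δ ≤ a := (min_le_right _ _).trans (min_le_left _ _)
  have hδb : δ ≤ b := (min_le_right _ _).trans (min_le_right _ _)
  -- the range `2` keeps `x` out of the column of a jumping point, the radius `δ / 2` keeps
  -- the whole column of `x` within distance `δ`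
  refine ⟨δ / 2, half_pos hδ0, μ + ν + 2, fun ε hε hεδ x hgx hx hxν => ?_⟩
  obtain ⟨k, hk⟩ := hgx.exists_mem_cell hε
  have hkc := cell_subset_closedCell ε k hk
  rw [stackCount_eq hε hk]
  have habs : ∀ z ∈ closedCell ε k, |z - x₀| < δ := fun z hz => by
    linarith [abs_sub_le z x x₀, abs_sub_le_of_mem_closedCell hz hkc]
  have hμν : x₀ ∈ jumpSet (⋃ i, P i) → (μ : ℝ) * ε + ν * ε + 2 * ε ≤ |x - x₀| := fun h => by
    have := hxν h
    push_cast at this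
    linarith
  have hμ0 : (0 : ℝ) ≤ μ * ε := by positivity
  have hν0 : (0 : ℝ) ≤ ν * ε := by positivity
  by_cases hx₀ : x₀ ∈ closedCell ε k
  · rw [hcol ε hε (by linarith) k hx₀, hnj _ x (by linarith)]
    intro hj
    linarith [hμν hj, abs_sub_le_of_mem_closedCell hkc hx₀]
  · rcases lt_or_ge x₀ (((k : ℝ) - 1) * ε) with h | h
    · refine hν ε hε (by linarith) k (fun z hz => ⟨z - x₀, ⟨?_, ?_⟩, by ring⟩) x hkc
        fun hj => by linarith [hμν hj]
      · linarith [hz.1]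
      · linarith [(abs_lt.1 (habs z hz)).2]
    · have h' : (k : ℝ) * ε < x₀ := by
        by_contra hle
        exact hx₀ ⟨h, not_lt.1 hle⟩
      refine hμ ε hε (by linarith) k (fun z hz => ⟨x₀ - z, ⟨?_, ?_⟩, by ring⟩) x hkc
        fun hj => by linarith [hμν hj]
      · linarith [hz.2]
      · linarith [(abs_lt.1 (habs z hz)).1]

lemma exists_abs_fst_le (hP : ∀ i, IsConvexPolygon (P i)) : ∃ R : ℝ, ∀ i, ∀ p ∈ P i, |p.1| ≤ R := by
  obtain ⟨R, hR⟩ := (isCompact_iUnion fun i => (hP i).1).isBounded.subset_closedBall 0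
  exact ⟨R, fun i p hp => (norm_fst_le p).trans
    (mem_closedBall_zero_iff.1 (hR (mem_iUnion_of_mem i hp)))⟩

theorem exists_isNoiseBound (hP : ∀ i, IsConvexPolygon (P i))
    (hgen : ∀ p q : ℝ × ℝ, IsVertex (⋃ n, P n) p → IsVertex (⋃ n, P n) q → p ≠ q → p.1 ≠ q.1) :
    ∃ (ν : ℕ) (ε₀ : ℝ), IsNoiseBound (⋃ i, P i) ν ε₀ := by
  choose δ hδ ν hν using exists_local_noiseBound hP hgen
  obtain ⟨R, hR⟩ := exists_abs_fst_le hP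
  obtain ⟨s, -, hs⟩ := (isCompact_Icc (a := -(R + 1)) (b := R + 1)).elim_nhds_subcover
    (fun x => Metric.ball x (δ x)) fun x _ => Metric.ball_mem_nhds x (hδ x)
  have hev : ∀ᶠ e in 𝓝[>] (0 : ℝ), ∀ x ∈ s, e < δ x :=
    (Finset.eventually_all s).2 fun x _ => nhdsWithin_le_nhds (Iio_mem_nhds (hδ x))
  obtain ⟨e, ⟨he, he1⟩, he0⟩ := ((hev.and (nhdsWithin_le_nhds (Iio_mem_nhds one_pos))).and
    self_mem_nhdsWithin).exists
  have he1 : e < 1 := he1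
  refine ⟨s.sup ν + 1, e, Nat.succ_pos _, he0, fun ε hε hεe x hgx hx => ?_⟩
  by_cases hxR : x ∈ Icc (-(R + 1)) (R + 1)
  · obtain ⟨x₀, hx₀s, hx₀⟩ := mem_iUnion₂.1 (hs hxR)
    refine hν x₀ ε hε (hεe.trans (he x₀ hx₀s)) x hgx hx₀ fun hj => le_trans ?_ (hx x₀ hj)
    refine mul_le_mul_of_nonneg_right ?_ hε.le
    exact_mod_cast (Finset.le_sup hx₀s).trans (Nat.le_succ _)
  · obtain ⟨k, hk⟩ := hgx.exists_mem_cell hε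
    have hfar : ∀ i, ∀ p ∈ P i, 1 < |p.1 - x| := fun i p hp => by
      by_contra hle
      have h1 := abs_le.1 (hR i p hp)
      have h2 := abs_le.1 (not_lt.1 hle)
      exact hxR ⟨by linarith, by linarith⟩
    rw [stackCount_eq hε hk, componentCount_strip_iUnion (fun i => (hP i).1)
      (fun i => (hP i).convex) hε, fiberCount_iUnion (fun i => (hP i).1) (fun i => (hP i).convex)]
    congr 1
    ext i j
    refine iff_of_false (fun h => ?_) fun ⟨y, hy, _⟩ => ?_
    · obtain ⟨p, hp, -, -, hpk, -⟩ := exists_near_of_overlap_strip h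
      linarith [hfar i p hp,
        abs_sub_le_of_mem_closedCell hpk (cell_subset_closedCell ε k hk)]
    · have := hfar i (x, y) hy
      simp only [sub_self, abs_zero] at this
      linarith

lemma finite_jumpSet (hP : ∀ i, IsConvexPolygon (P i)) : (jumpSet (⋃ i, P i)).Finite := by
  choose δ hδ h using exists_notMem_jumpSet_near hP
  obtain ⟨R, hR⟩ := exists_abs_fst_le hP
  obtain ⟨s, -, hs⟩ := (isCompact_Icc (a := -R) (b := R)).elim_nhds_subcover
    (fun x => Metric.ball x (δ x)) fun x _ => Metric.ball_mem_nhds x (hδ x)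
  refine s.finite_toSet.subset fun x hx => ?_
  have hxR : x ∈ Icc (-R) R := by
    rw [mem_Icc, ← abs_le]
    by_contra hlt
    have hzero : ∀ z, R < |z| → fiberCount (⋃ i, P i) z = 0 := fun z hz => by
      have : fiber (⋃ i, P i) z = ∅ := by
        rw [eq_empty_iff_forall_notMem]
        intro y hy
        obtain ⟨i, hi⟩ := mem_iUnion.1 hy
        exact absurd (hR i _ hi) (not_le.2 hz)
      change Nat.card (ConnectedComponents (fiber (⋃ i, P i) z)) = 0
      rw [this]
      have : IsEmpty (ConnectedComponents (∅ : Set ℝ)) :=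
        ConnectedComponents.surjective_coe.isEmpty
      exact Nat.card_of_isEmpty
    have hpos : 0 < |x| - R := sub_pos.2 (not_le.1 hlt)
    have hz : ∀ z, |x - z| < |x| - R → fiberCount (⋃ i, P i) z = 0 := fun z hz =>
      hzero z (by linarith [abs_sub_abs_le_abs_sub x z])
    rw [mem_jumpSet_iff hpos
      (fun z hzx => hz z (abs_lt.2 ⟨by linarith [hzx.2], by linarith [hzx.1]⟩))
      (fun z hzx => hz z (abs_lt.2 ⟨by linarith [hzx.2], by linarith [hzx.1]⟩)),
      hzero x (not_le.1 hlt)] at hx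
    simp at hx
  obtain ⟨x₀, hx₀s, hx₀⟩ := mem_iUnion₂.1 (hs hxR)
  rw [h x₀ x hx hx₀]
  exact hx₀s

/-- For small `ε` the column over a jumping point `x₀` has as many components as the fiber over
`x₀`, while the columns just outside the noise range have as many as the fibers next to `x₀`. If the
latter number differs on the left or on the right, the stack counter jumps in between. -/
lemma exists_mem_pixelJumpSet (hP : ∀ i, IsConvexPolygon (P i)) {ν : ℕ} {ε₀ : ℝ}
    (hν : IsNoiseBound (⋃ i, P i) ν ε₀) {x₀ : ℝ} (hx₀ : x₀ ∈ jumpSet (⋃ i, P i)) :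
    ∃ r > 0, ∀ ε > 0, ε < ε₀ → ε < r → ∃ z ∈ pixelJumpSet (⋃ i, P i) ε,
      z ∈ Icc (x₀ - ν * ε) (x₀ + ν * ε) := by
  obtain ⟨δ, hδ, m, n, hm, hn⟩ := exists_fiberCount_eq_near hP x₀
  obtain ⟨d, hd, hiso⟩ := exists_notMem_jumpSet_near hP x₀
  obtain ⟨e, he, hcol⟩ := exists_componentCount_strip_eq hP x₀
  refine ⟨min e (min δ d / (2 * ν + 2)), by positivity, fun ε hε hε₀ hεr => ?_⟩
  have hν0 : (0 : ℝ) ≤ ν * ε := by positivity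
  have hεδ : ε * (2 * ν + 2) < min δ d :=
    (lt_div_iff₀ (by positivity)).1 (hεr.trans_le (min_le_right _ _))
  have hεδ' := hεδ.trans_le (min_le_left _ _)
  have hεd := hεδ.trans_le (min_le_right _ _)
  have hεe := hεr.trans_le (min_le_left _ _)
  have hstack : ∀ x, ∀ k : ℤ, x ∈ cell ε k → ν * ε ≤ |x - x₀| → |x - x₀| ≤ (ν + 1) * ε →
      componentCount (strip ε (⋃ i, P i) k) = fiberCount (⋃ i, P i) x := by
    intro x k hk h1 h2
    rw [← stackCount_eq hε hk]
    refine hν.2.2 ε hε hε₀ x (isGenericPoint_of_mem_cell hε hk) fun x₁ hx₁ => ?_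
    by_cases h : |x₁ - x₀| < d
    · rwa [hiso x₁ hx₁ h]
    · have := abs_sub_le x₁ x x₀
      rw [abs_sub_comm x₁ x] at this
      linarith
  rw [mem_jumpSet_iff hδ hm hn] at hx₀
  rcases hx₀ with hne | hne
  · -- the cell `k` has `x₀` in its interior or as its right end point
    set k := ⌈x₀ / ε⌉
    have hk1 : ((k : ℝ) - 1) * ε < x₀ := by
      rw [← lt_div_iff₀ hε]; linarith [Int.ceil_lt_add_one (x₀ / ε)]
    have hk2 : x₀ ≤ k * ε := by rw [← div_le_iff₀ hε]; exact Int.le_ceil _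
    obtain ⟨x, hx1, hx2⟩ := exists_between
      (show ((k : ℝ) - 1) * ε - ν * ε < x₀ - ν * ε by linarith)
    have habs : |x - x₀| = x₀ - x := by rw [abs_sub_comm, abs_of_pos (by linarith)]
    have hs := hstack x (k - ν)
      ⟨by push_cast; linarith, by push_cast; linarith⟩ (by linarith) (by linarith)
    rw [hm x ⟨by linarith, by linarith⟩] at hs
    obtain ⟨j, hj1, hj2, hj⟩ := exists_step_ne (f := fun k => componentCount (strip ε (⋃ i, P i) k))
      ν (a := k - ν) (by
        simp only [sub_add_cancel]
        rw [hs, hcol ε hε hεe k ⟨hk1.le, hk2⟩]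
        exact hne.symm)
    have hj1' : (k : ℝ) - ν ≤ j := by exact_mod_cast hj1
    have hj2' : (j : ℝ) ≤ k - 1 := by
      have : j ≤ k - 1 := by omega
      exact_mod_cast this
    have h1 := mul_le_mul_of_nonneg_right hj1' hε.le
    have h2 := mul_le_mul_of_nonneg_right hj2' hε.le
    exact ⟨_, mem_pixelJumpSet hε hj, by linarith, by linarith⟩
  · -- the cell `k + 1` has `x₀` in its interior or as its left end point
    set k := ⌊x₀ / ε⌋
    have hk1 : (k : ℝ) * ε ≤ x₀ := by rw [← le_div_iff₀ hε]; exact Int.floor_le _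
    have hk2 : x₀ < ((k : ℝ) + 1) * ε := by
      rw [← div_lt_iff₀ hε]; exact Int.lt_floor_add_one _
    obtain ⟨x, hx1, hx2⟩ := exists_between
      (show x₀ + ν * ε < ((k : ℝ) + 1) * ε + ν * ε by linarith)
    have habs : |x - x₀| = x - x₀ := abs_of_pos (by linarith)
    have hs := hstack x (k + 1 + ν)
      ⟨by push_cast; linarith, by push_cast; linarith⟩ (by linarith) (by linarith)
    rw [hn x ⟨by linarith, by linarith⟩] at hs
    obtain ⟨j, hj1, hj2, hj⟩ := exists_step_ne (f := fun k => componentCount (strip ε (⋃ i, P i) k))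
      ν (a := k + 1) (by
        rw [hs, hcol ε hε hεe (k + 1) ⟨by push_cast; linarith, by push_cast; linarith⟩]
        exact hne)
    have hj1' : (k : ℝ) + 1 ≤ j := by exact_mod_cast hj1
    have hj2' : (j : ℝ) ≤ k + ν := by
      have : j ≤ k + ν := by omega
      exact_mod_cast this
    have h1 := mul_le_mul_of_nonneg_right hj1' hε.le
    have h2 := mul_le_mul_of_nonneg_right hj2' hε.le
    exact ⟨_, mem_pixelJumpSet hε hj, by linarith, by linarith⟩

end Family

end Pixelation

theorem mainTheorem3 (S : Set (ℝ × ℝ)) (hS : Pixelation.IsGenericPLSet S) :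
    (∃ (ν : ℕ) (ε₀ : ℝ), Pixelation.IsNoiseBound S ν ε₀) ∧
    ∀ (ν : ℕ) (ε₀ : ℝ), Pixelation.IsNoiseBound S ν ε₀ →
      ∃ ε₁ : ℝ, 0 < ε₁ ∧ ∀ ε : ℝ, 0 < ε → ε < min ε₀ ε₁ →
        ∀ x₀ ∈ Pixelation.jumpSet S,
          ∃ z ∈ Pixelation.pixelJumpSet S ε, z ∈ Set.Icc (x₀ - ν * ε) (x₀ + ν * ε) := by
  obtain ⟨⟨F, hF, hP, rfl⟩, hgen⟩ := hS
  have : Finite F := hF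
  rw [sUnion_eq_iUnion] at *
  have hP' : ∀ i : F, Pixelation.IsConvexPolygon (i : Set (ℝ × ℝ)) := fun i => hP i i.2
  refine ⟨Pixelation.exists_isNoiseBound hP' hgen, fun ν ε₀ hν => ?_⟩
  have hloc : ∀ x₀ : ℝ, ∃ r > 0, x₀ ∈ Pixelation.jumpSet (⋃ i : F, (i : Set (ℝ × ℝ))) →
      ∀ ε > 0, ε < ε₀ → ε < r →
        ∃ z ∈ Pixelation.pixelJumpSet (⋃ i : F, (i : Set (ℝ × ℝ))) ε,
          z ∈ Icc (x₀ - ν * ε) (x₀ + ν * ε) := by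
    intro x₀
    by_cases hx₀ : x₀ ∈ Pixelation.jumpSet (⋃ i : F, (i : Set (ℝ × ℝ)))
    · obtain ⟨r, hr, h⟩ := Pixelation.exists_mem_pixelJumpSet hP' hν hx₀
      exact ⟨r, hr, fun _ => h⟩
    · exact ⟨1, one_pos, fun h => (hx₀ h).elim⟩
  choose r hr h using hloc
  have hev : ∀ᶠ e in 𝓝[>] (0 : ℝ), ∀ x₀ ∈ Pixelation.jumpSet (⋃ i : F, (i : Set (ℝ × ℝ))),
      e < r x₀ :=
    (eventually_all_finite (Pixelation.finite_jumpSet hP')).2 fun x _ =>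
      nhdsWithin_le_nhds (Iio_mem_nhds (hr x))
  obtain ⟨e, he, he0⟩ := (hev.and self_mem_nhdsWithin).exists
  exact ⟨e, he0, fun ε hε hεe x₀ hx₀ => h x₀ hx₀ ε hε (hεe.trans_le (min_le_left _ _))
    ((hεe.trans_le (min_le_right _ _)).trans (he x₀ hx₀))⟩
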